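/- Observe $Z=(Z_1,\dots,Z_n)$, $Z_i=(y_i,X_{i\cdot})\in\mathbb{R}^{p+1}$, from the linear model $y=X\beta+\epsilon$, where the rows $X_{i\cdot}$ are i.i.d. $N_p(0,\Omega^{-1})$ and independent of $\epsilon\sim N_n(0,\sigma^2 I)$; write $\theta=(\beta,\Omega,\sigma)$ and $\mathbb{P}_\theta$, $\mathbb{E}_\theta$ for the law of $Z$ and its expectation. Fix constants $M_1>1$, $M_2>0$ and let $$\Theta(k)=\Big\{(\beta,\Omega,\sigma):\ \|\beta\|_0\le k,\ \tfrac1{M_1}\le\lambda_{\min}(\Omega)\le\lambda_{\max}(\Omega)\le M_1,\ 0<\sigma\le M_2\Big\},$$ where $\Omega$ is symmetric and $\|v\|_0$ is the number of nonzero coordinates of $v$. For a loading $\xi\in\mathbb{R}^p$ let $\mathcal{I}_\alpha(\Theta(k),\xi^\top\beta)$ be the set of all intervals $[l(Z),u(Z)]$ with $l,u$ real-valued and measurable and $\mathbb{P}_\theta(l(Z)\le\xi^\top\beta\le u(Z))\ge 1-\alpha$ for every $\theta\in\Theta(k)$, and for $k_1\le k$ let $$L^*_\alpha(\Theta(k_1),\Theta(k),\xi^\top\beta)=\inf_{[l,u]\in\mathcal{I}_\alpha(\Theta(k),\xi^\top\beta)}\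 \sup_{\theta\in\Theta(k_1)}\mathbb{E}_\theta\big[\text{length of }[l(Z),u(Z)]\big]\in[0,\infty].$$ Fix $0<\alpha<\frac12$, $0\le\gamma<\frac12$, $c>0$, $C>0$ and $\bar c\ge1$. Consider integers $n\ge1$, $p\ge2$, $0\le k_1\le k$ with $k\ge1$ and $(k_1,k)\ne(0,1)$ such that $$k\le c\min\Big\{p^\gamma,\frac{n}{\log p}\Big\},$$ and a sparse loading $\xi\in\mathbb{R}^p$, that is, $\xi\ne0$, $\|\xi\|_0\le Ck$ and $\max_{j\in\mathrm{supp}(\xi)}|\xi_j|\le\bar c\,\min_{j\in\mathrm{supp}(\xi)}|\xi_j|$. (1) There is a constant $c_1>0$, depending only on $\alpha,\gamma,c,C,\bar c,M_1,M_2$, such that for all such $n,p,k_1,k,\xi$ $$L^*_\alpha(\Theta(k_1),\Theta(k),\xi^\top\beta)\ \ge\ c_1\|\xi\|_2\Big(\frac1{\sqrt n}+k\frac{\log p}{n}\Big).$$ (2) Consequently, along any sequence of such $(n,p,k_1,k,\xi)$ with $k_1/k\to0$ and $\frac{\sqrt n}{\log p}/k\to0$, $$\frac{L^*_\alpha(\Theta(k_1),\Theta(k),\xi^\top\beta)}{\|\xi\|_2\big(\frac1{\sqrt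 n}+k_1\frac{\log p}{n}\big)}\ \longrightarrow\ \infty ,$$ so that no confidence interval with coverage $1-\alpha$ over $\Theta(k)$ attains over $\Theta(k_1)$ a maximal expected length of the order $\|\xi\|_2\big(\frac1{\sqrt n}+k_1\frac{\log p}{n}\big)$. -/

import Mathlib

open MeasureTheory ProbabilityTheory Filter Topology
open scoped ENNReal

noncomputable section

namespace HighDimCI

/-- The parameter `θ = (β, Ω, σ)` of the Gaussian random-design linear model: regression vector,
precision matrix of the design rows, and noise level. -/
structure Param (p : ℕ) where
  /-- the regression vector -/
  β : EuclideanSpace ℝ (Fin p)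
  /-- the precision matrix (inverse covariance matrix) of the rows of the design -/
  Ω : Matrix (Fin p) (Fin p) ℝ
  /-- the noise level -/
  σ : ℝ

/-- The number `‖v‖₀` of nonzero coordinates of a vector. -/
def l0norm {p : ℕ} (v : EuclideanSpace ℝ (Fin p)) : ℕ := hammingNorm v.ofLp

/-- The parameter space `Θ(k)`: `k`-sparse regression vectors, symmetric precision matrices all of
whose eigenvalues lie in `[1 / M₁, M₁]`, and noise levels in `(0, M₂]`. -/
def Theta (M₁ M₂ : ℝ) (p k : ℕ) : Set (Param p) :=
  {θ | l0norm θ.β ≤ k ∧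
    (∃ h : θ.Ω.IsHermitian, ∀ i, 1 / M₁ ≤ h.eigenvalues i ∧ h.eigenvalues i ≤ M₁) ∧
    0 < θ.σ ∧ θ.σ ≤ M₂}

/-- The set `Ξ(q, cbar)` of nonzero loadings with exactly `q` nonzero coordinates, the ratio of the
largest to the smallest absolute value of these coordinates being at most `cbar`. -/
def Xi (p q : ℕ) (cbar : ℝ) : Set (EuclideanSpace ℝ (Fin p)) :=
  {ξ | l0norm ξ = q ∧ ξ ≠ 0 ∧ ∀ i j, ξ i ≠ 0 → ξ j ≠ 0 → |ξ i| / |ξ j| ≤ cbar}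

/-- The law of one observation `(yᵢ, Xᵢ)`, where `yᵢ = ⟨Xᵢ, β⟩ + εᵢ` with independent
`Xᵢ ∼ N(0, Ω⁻¹)` and `εᵢ ∼ N(0, σ²)`. -/
def obsLaw {p : ℕ} (θ : Param p) : Measure (ℝ × EuclideanSpace ℝ (Fin p)) :=
  ((multivariateGaussian (0 : EuclideanSpace ℝ (Fin p)) θ.Ω⁻¹).prod
      (gaussianReal 0 (θ.σ ^ 2).toNNReal)).map
    (fun w => (inner ℝ w.1 θ.β + w.2, w.1))

instance isProbabilityMeasure_obsLaw {p : ℕ} (θ : Param p) : IsProbabilityMeasure (obsLaw θ) :=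
  Measure.isProbabilityMeasure_map (Measurable.aemeasurable (by fun_prop))

/-- The data space: `n` observations `Zᵢ = (yᵢ, Xᵢ)`. -/
abbrev Data (n p : ℕ) : Type := Fin n → ℝ × EuclideanSpace ℝ (Fin p)

/-- The law `P_θ` of the data `Z = (Z₁, …, Zₙ)`, the `Zᵢ` being i.i.d. -/
def dataLaw (n : ℕ) {p : ℕ} (θ : Param p) : Measure (Data n p) :=
  Measure.pi (fun _ : Fin n => obsLaw θ)

/-- A data-dependent interval `[l(Z), u(Z)]` with measurable end points (empty where `u < l`). -/
structure RandomInterval (n p : ℕ) where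
  /-- the lower end point `l` -/
  lower : Data n p → ℝ
  /-- the upper end point `u` -/
  upper : Data n p → ℝ
  measurable_lower : Measurable lower
  measurable_upper : Measurable upper

/-- The set of `(1 - α)`-level confidence intervals for `T(β)` over the parameter space `S`. -/
def confidenceIntervals (n : ℕ) {p : ℕ} (α : ℝ) (S : Set (Param p))
    (T : EuclideanSpace ℝ (Fin p) → ℝ) : Set (RandomInterval n p) :=
  {I | ∀ θ ∈ S,
    ENNReal.ofReal (1 - α) ≤ dataLaw n θ {z | I.lower z ≤ T θ.β ∧ T θ.β ≤ I.upper z}}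

/-- The expected length of `[l(Z), u(Z)]` under `P_θ`, as a value in `[0, ∞]`; the length
is `u - l` where `l ≤ u`, and `0` where the interval is empty. -/
def expectedLength {n p : ℕ} (I : RandomInterval n p) (θ : Param p) : ℝ≥0∞ :=
  ∫⁻ z, ENNReal.ofReal (I.upper z - I.lower z) ∂(dataLaw n θ)

/-- The maximum expected length over the parameter space `S`. -/
def maxExpectedLength {n p : ℕ} (I : RandomInterval n p) (S : Set (Param p)) : ℝ≥0∞ :=
  ⨆ θ ∈ S, expectedLength I θ

/-- The benchmark `L*_α(S₁, S, T)`: the infimum of the maximum expected length over `S₁` among all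
`(1 - α)`-level confidence intervals for `T(β)` over `S`. -/
def benchmark (n : ℕ) {p : ℕ} (α : ℝ) (S₁ S : Set (Param p))
    (T : EuclideanSpace ℝ (Fin p) → ℝ) : ℝ≥0∞ :=
  ⨅ I ∈ confidenceIntervals n α S T, maxExpectedLength I S₁

/-- The rate `‖ξ‖₂ (1 / √n + k log p / n)`. -/
def rate (n : ℕ) {p : ℕ} (k : ℕ) (ξ : EuclideanSpace ℝ (Fin p)) : ℝ :=
  ‖ξ‖ * (1 / √(n : ℝ) + k * (Real.log p / n))

end HighDimCI

end

open HighDimCI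

/-!
The lower bound compares a null model with alternatives that the data cannot tell apart from it, but
under which the value of the functional differs: an interval that covers both values with
probability bounded below is at least as long as their distance on an event of probability bounded
below (`le_expectedLength_of_shear`).

All models are images of a standard Gaussian latent vector `z = (X, e)`, the design row and the
noise. In the null model the response is `y = b ⟪v, X⟫ + s e`, where `v` is a unit vector obtained by
restricting the loading to part of its support. In the alternatives `z` is replaced by the shear
`z + ⟪l, z⟫ u`, where `l` and `u` are orthogonal. A shear preserves Lebesgue measure, so its density
with respect to the Gaussian is explicit, and the second moment of a pair of such densities is at
most `exp (2 ⟪u, u'⟫ ‖l‖ ^ 2)` (`lintegral_shearDensity_mul_le`).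

Two choices of the shear give the two terms of the rate.

* Shearing the noise along `⟪v, X⟫` by a multiple of order `1 / √n` adds to the regression vector a
  multiple of `v` of that order (`le_expectedLength_parametric`).
* Shearing the design by `a (⟪v, X⟫ + s e)` in `m` coordinates outside the support of the loading,
  where `a ^ 2` is of order `log p / n`, leaves the response as it is. Both `⟪v, X⟫` and the noise
  become correlated with the `m` coordinates, and regressing the response on the new design moves
  the coefficient of `v` by `m a ^ 2 s ^ 2 / (1 + m a ^ 2 s ^ 2)`, which is of order `k log p / n`
  (`obsLaw_shearCov`). The coordinates are unknown: one is chosen uniformly from each of `m` blocks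
  of size of order `p / m`. The number of coincidences of two choices is a sum of independent
  indicators, so the second moment of the mixture is at most `exp (m ^ 2 p ^ κ / p)` up to constants,
  which tends to one since `m` is at most of order `p ^ γ` with `γ < 1 / 2`
  (`le_expectedLength_mixture`).

For bounded `p` the second term of the rate is dominated by the first.

The divergence of the ratio follows: the ratio is at least a constant times the inverse of
`(√n / log p) / k + k₁ / k`.
-/

/-! ### Product measures and densities -/

/-- Tonelli's theorem for a product of functions of the separate coordinates. -/
theorem lintegral_fin_prod_eq_prod {n : ℕ} {E : Type*} [MeasurableSpace E]
    (μ : Fin n → Measure E) [∀ i, SigmaFinite (μ i)] (f : Fin n → E → ℝ≥0∞)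
    (hf : ∀ i, Measurable (f i)) :
    ∫⁻ x : Fin n → E, ∏ i, f i (x i) ∂(Measure.pi μ) = ∏ i, ∫⁻ x, f i x ∂(μ i) := by
  induction n with
  | zero => simp
  | succ n ih =>
    rw [← ((measurePreserving_piFinSuccAbove μ 0).symm).lintegral_comp_emb
      (MeasurableEquiv.measurableEmbedding _)]
    simp_rw [MeasurableEquiv.piFinSuccAbove_symm_apply, Fin.insertNthEquiv,
      Fin.prod_univ_succ, Fin.insertNth_zero, Equiv.coe_fn_mk, Fin.cons_succ,
      Fin.zero_succAbove, cast_eq, Fin.cons_zero]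
    rw [lintegral_prod_mul (f := f 0)
      (g := fun x : Fin n → E => ∏ i : Fin n, f i.succ (x i)) (hf 0).aemeasurable
      (Finset.measurable_prod _ fun i _ =>
        (hf i.succ).comp (measurable_pi_apply i)).aemeasurable]
    rw [ih (fun i => μ i.succ) (fun i => f i.succ) fun i => hf i.succ]

/-- The product of measures with densities has the product density. -/
theorem pi_withDensity {n : ℕ} {E : Type*} [MeasurableSpace E]
    (μ : Measure E) [SigmaFinite μ] (f : E → ℝ≥0∞) (hf : Measurable f)
    [SigmaFinite (μ.withDensity f)] :
    Measure.pi (fun _ : Fin n => μ.withDensity f) =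
      (Measure.pi fun _ : Fin n => μ).withDensity fun x => ∏ i, f (x i) := by
  refine Measure.pi_eq fun s hs => ?_
  have hmeas : MeasurableSet (Set.univ.pi s) := MeasurableSet.univ_pi hs
  rw [withDensity_apply _ hmeas, ← lintegral_indicator hmeas]
  have h : ∀ x : Fin n → E, (Set.univ.pi s).indicator (fun x => ∏ i, f (x i)) x =
      ∏ i, (s i).indicator f (x i) := by
    intro x
    by_cases hx : x ∈ Set.univ.pi s
    · rw [Set.indicator_of_mem hx]
      exact Finset.prod_congr rfl fun i _ => (Set.indicator_of_mem (hx i trivial) _).symm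
    · rw [Set.indicator_of_notMem hx]
      simp only [Set.mem_pi, Set.mem_univ, true_imp_iff, not_forall] at hx
      obtain ⟨i, hi⟩ := hx
      exact (Finset.prod_eq_zero (Finset.mem_univ i) (Set.indicator_of_notMem hi _)).symm
  simp_rw [h]
  rw [lintegral_fin_prod_eq_prod _ _ fun i => hf.indicator (hs i)]
  refine Finset.prod_congr rfl fun i _ => ?_
  rw [lintegral_indicator (hs i), withDensity_apply _ (hs i)]

/-! ### Shears of the standard Gaussian measure -/

section Gaussian

open scoped RealInnerProductSpace

variable {E : Type*} [NormedAddCommGroup E] [InnerProductSpace ℝ E] [FiniteDimensional ℝ E]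
  [MeasurableSpace E] [BorelSpace E]

/-- The Lebesgue density of the standard Gaussian measure. -/
theorem stdGaussian_eq_withDensity :
    stdGaussian E = volume.withDensity fun x : E =>
      ENNReal.ofReal ((√(2 * Real.pi))⁻¹ ^ Module.finrank ℝ E * Real.exp (-‖x‖ ^ 2 / 2)) := by
  have : SigmaFinite ((volume : Measure ℝ).withDensity (gaussianPDF 0 1)) := by
    rw [← gaussianReal_of_var_ne_zero 0 one_ne_zero]; infer_instance
  have hpi := pi_withDensity (n := Module.finrank ℝ E) (volume : Measure ℝ) (gaussianPDF 0 1)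
    (measurable_gaussianPDF 0 1)
  set b := stdOrthonormalBasis ℝ E
  have hmp : MeasurePreserving (fun x : Fin (Module.finrank ℝ E) → ℝ => b.repr.symm (WithLp.toLp 2 x))
      volume volume :=
    b.measurePreserving_repr_symm.comp (PiLp.volume_preserving_toLp _)
  have hfun : (fun x : Fin (Module.finrank ℝ E) → ℝ => ∑ i, x i • b i) =
      fun x => b.repr.symm (WithLp.toLp 2 x) := by
    ext x
    rw [← b.sum_repr_symm]
  rw [stdGaussian, hfun, gaussianReal_of_var_ne_zero 0 one_ne_zero, hpi]
  ext A hA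
  rw [Measure.map_apply hmp.measurable hA, withDensity_apply _ (hmp.measurable hA),
    withDensity_apply _ hA, ← hmp.setLIntegral_comp_preimage hA (by fun_prop)]
  refine lintegral_congr fun x => ?_
  simp only [gaussianPDF, gaussianPDFReal]
  rw [← ENNReal.ofReal_prod_of_nonneg fun i _ => by positivity, Finset.prod_mul_distrib,
    ← Real.exp_sum, LinearIsometryEquiv.norm_map, EuclideanSpace.real_norm_sq_eq,
    ← Finset.sum_div, Finset.sum_neg_distrib]
  simp

/-- The linear shear `x ↦ x + ⟪l, x⟫ u`. -/
noncomputable def shear (l u : E) (x : E) : E := x + ⟪l, x⟫ • u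

/-- For `⟪l, u⟫ = 0`, the density of the shear `x ↦ x + ⟪l, x⟫ u` of the standard Gaussian measure
with respect to that measure. -/
noncomputable def shearDensity (l u : E) (x : E) : ℝ :=
  Real.exp (⟪l, x⟫ * ⟪u, x⟫ - ⟪l, x⟫ ^ 2 * ‖u‖ ^ 2 / 2)

@[fun_prop]
theorem measurable_shear (l u : E) : Measurable (shear l u) := by
  unfold shear; fun_prop

@[fun_prop]
theorem measurable_shearDensity (l u : E) : Measurable (shearDensity l u) := by
  unfold shearDensity; fun_prop

omit [FiniteDimensional ℝ E] [MeasurableSpace E] [BorelSpace E] in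
theorem inner_shear {l u : E} (h : ⟪l, u⟫ = 0) (x : E) : ⟪l, shear l u x⟫ = ⟪l, x⟫ := by
  simp [shear, inner_add_right, inner_smul_right, h]

/-- The change of variables formula for a shear of the standard Gaussian measure; it holds since the
shear has determinant one. -/
theorem lintegral_shear {l u : E} (h : ⟪l, u⟫ = 0) {F : E → ℝ≥0∞} (hF : Measurable F) :
    ∫⁻ x, F (shear l u x) ∂(stdGaussian E) =
      ∫⁻ x, F x * ENNReal.ofReal (shearDensity l u x) ∂(stdGaussian E) := by
  have hdet : LinearMap.det (LinearMap.transvection (innerₛₗ ℝ l) u) = 1 := by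
    rw [LinearMap.transvection.det]; simp [h]
  have hmap : (volume : Measure E).map (shear l u) = volume := by
    have := Measure.map_linearMap_addHaar_eq_smul_addHaar (volume : Measure E)
      (f := LinearMap.transvection (innerₛₗ ℝ l) u) (by rw [hdet]; exact one_ne_zero)
    rw [hdet, inv_one, abs_one, ENNReal.ofReal_one, one_smul] at this
    exact this
  have hmp : MeasurePreserving (shear l u) (volume : Measure E) volume :=
    ⟨measurable_shear l u, hmap⟩
  rw [stdGaussian_eq_withDensity, lintegral_withDensity_eq_lintegral_mul _ (by fun_prop)
    (by fun_prop), lintegral_withDensity_eq_lintegral_mul _ (by fun_prop) (by fun_prop)]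
  symm
  rw [← hmp.lintegral_comp (by fun_prop)]
  refine lintegral_congr fun x => ?_
  simp only [Pi.mul_apply]
  rw [mul_left_comm, mul_comm (ENNReal.ofReal _) (F _), ← ENNReal.ofReal_mul (by positivity)]
  congr 2
  rw [shearDensity, inner_shear h, mul_assoc, ← Real.exp_add]
  congr 2
  have h1 : ⟪u, shear l u x⟫ = ⟪u, x⟫ + ⟪l, x⟫ * ‖u‖ ^ 2 := by
    simp [shear, inner_add_right, inner_smul_right]
  have h2 : ‖shear l u x‖ ^ 2 = ‖x‖ ^ 2 + 2 * (⟪l, x⟫ * ⟪u, x⟫) + ⟪l, x⟫ ^ 2 * ‖u‖ ^ 2 := by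
    rw [shear, norm_add_sq_real, inner_smul_right, norm_smul, mul_pow, Real.norm_eq_abs, sq_abs,
      real_inner_comm u x]
  rw [h1, h2]; ring

theorem map_shear_stdGaussian {l u : E} (h : ⟪l, u⟫ = 0) :
    (stdGaussian E).map (shear l u) =
      (stdGaussian E).withDensity fun x => ENNReal.ofReal (shearDensity l u x) := by
  ext A hA
  have := lintegral_shear h (F := A.indicator 1) (measurable_one.indicator hA)
  rw [Measure.map_apply (by fun_prop) hA, withDensity_apply _ hA,
    ← lintegral_indicator_one ((measurable_shear l u) hA), ← lintegral_indicator hA]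
  refine Eq.trans ?_ (this.trans ?_)
  · rfl
  · refine lintegral_congr fun x => ?_
    by_cases hx : x ∈ A <;> simp [hx]

/-- The exponential moment of a multiple of the square of a standard Gaussian variable. -/
theorem lintegral_exp_sq_gaussianReal_le {b : ℝ} (hb0 : 0 ≤ b) (hb : b ≤ 1 / 4) :
    ∫⁻ z, ENNReal.ofReal (Real.exp (b * z ^ 2)) ∂(gaussianReal 0 1) ≤
      ENNReal.ofReal (Real.exp (2 * b)) := by
  rw [gaussianReal_of_var_ne_zero 0 one_ne_zero, lintegral_withDensity_eq_lintegral_mul _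
    (measurable_gaussianPDF 0 1) (by fun_prop)]
  have hpos : 0 < 1 / 2 - b := by linarith
  have h : ∀ z : ℝ, (gaussianPDF 0 1 * fun z : ℝ => ENNReal.ofReal (Real.exp (b * z ^ 2))) z =
      ENNReal.ofReal ((√(2 * Real.pi))⁻¹ * Real.exp (-(1 / 2 - b) * z ^ 2)) := by
    intro z
    simp only [Pi.mul_apply, gaussianPDF, gaussianPDFReal]
    rw [← ENNReal.ofReal_mul (by positivity), mul_assoc, ← Real.exp_add]
    congr 2
    · simp
    · congr 1; simp only [NNReal.coe_one]; ring
  rw [lintegral_congr h, ← ofReal_integral_eq_lintegral_ofReal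
    ((integrable_exp_neg_mul_sq hpos).const_mul _) (ae_of_all _ fun z => by positivity),
    integral_const_mul, integral_gaussian]
  apply ENNReal.ofReal_le_ofReal
  rw [← Real.sqrt_inv, ← Real.sqrt_mul (by positivity)]
  apply Real.sqrt_le_iff.2 ⟨by positivity, ?_⟩
  have h1 : (2 * Real.pi)⁻¹ * (Real.pi / (1 / 2 - b)) = 1 / (1 - 2 * b) := by
    have := Real.pi_ne_zero
    have h2 : 1 - 2 * b ≠ 0 := by linarith
    have h3 : 1 / 2 - b ≠ 0 := by linarith
    field_simp
  rw [h1, ← Real.exp_nat_mul, div_le_iff₀ (by linarith)]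
  have h4 := Real.add_one_le_exp (((2 : ℕ) : ℝ) * (2 * b))
  push_cast at h4 ⊢
  nlinarith

theorem lintegral_exp_inner_sq_le {l : E} {J : ℝ} (hJ : 0 ≤ J) (hJl : J * ‖l‖ ^ 2 ≤ 1 / 4) :
    ∫⁻ x, ENNReal.ofReal (Real.exp (J * ⟪l, x⟫ ^ 2)) ∂(stdGaussian E) ≤
      ENNReal.ofReal (Real.exp (2 * (J * ‖l‖ ^ 2))) := by
  have hmap : (stdGaussian E).map (innerSL ℝ l) = (gaussianReal 0 1).map (fun z => ‖l‖ * z) := by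
    rw [IsGaussian.map_eq_gaussianReal, gaussianReal_map_const_mul]
    congr 1
    · exact integral_strongDual_stdGaussian (innerSL ℝ l) |>.trans (by simp)
    · rw [variance_dual_stdGaussian]
      ext; simp
  calc _ = ∫⁻ y, ENNReal.ofReal (Real.exp (J * y ^ 2)) ∂((stdGaussian E).map (innerSL ℝ l)) := by
        rw [lintegral_map (by fun_prop) (by fun_prop)]; rfl
    _ = ∫⁻ z, ENNReal.ofReal (Real.exp (J * ‖l‖ ^ 2 * z ^ 2)) ∂(gaussianReal 0 1) := by
        rw [hmap, lintegral_map (by fun_prop) (by fun_prop)]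
        simp_rw [mul_pow, mul_assoc]
    _ ≤ _ := lintegral_exp_sq_gaussianReal_le (by positivity) hJl

/-- The product of two shear densities is, after the sheared change of variables, the exponential
of a multiple of a squared linear form. -/
theorem lintegral_shearDensity_mul_le {l u u' : E} (hu : ⟪l, u⟫ = 0) (hu' : ⟪l, u'⟫ = 0)
    (hJ : 0 ≤ ⟪u, u'⟫) (hJl : ⟪u, u'⟫ * ‖l‖ ^ 2 ≤ 1 / 4) :
    ∫⁻ x, ENNReal.ofReal (shearDensity l u x * shearDensity l u' x) ∂(stdGaussian E) ≤
      ENNReal.ofReal (Real.exp (2 * (⟪u, u'⟫ * ‖l‖ ^ 2))) := by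
  have hsum : ⟪l, u + u'⟫ = 0 := by rw [inner_add_right, hu, hu', add_zero]
  refine le_trans (le_of_eq ?_) (lintegral_exp_inner_sq_le (l := l) hJ hJl)
  have h := lintegral_shear hsum
    (F := fun x => ENNReal.ofReal (Real.exp (⟪u, u'⟫ * ⟪l, x⟫ ^ 2))) (by fun_prop)
  simp_rw [inner_shear hsum] at h
  rw [h]
  refine lintegral_congr fun x => ?_
  rw [← ENNReal.ofReal_mul (Real.exp_pos _).le]
  congr 1
  simp only [shearDensity]
  rw [← Real.exp_add, ← Real.exp_add, norm_add_sq_real, inner_add_left]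
  congr 1; ring

end Gaussian

/-! ### The second moment method for mixtures -/

/-- An event of probability at least `1 - α` under the uniform mixture of the measures with
densities `g i` has probability at least `1 - α - ε` under `μ`, if the `χ²`-divergence of the
mixture from `μ` is at most `ε ^ 2`. -/
theorem measureReal_ge_of_mixture {X ι : Type*} [MeasurableSpace X] [Fintype ι] [Nonempty ι]
    (μ : Measure X) [IsProbabilityMeasure μ] {g : ι → X → ℝ} (hg : ∀ i, Measurable (g i))
    (hg0 : ∀ i x, 0 ≤ g i x) (hg1 : ∀ i, ∫⁻ x, ENNReal.ofReal (g i x) ∂μ = 1)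
    {r : ι → ι → ℝ} (hr0 : ∀ i j, 0 ≤ r i j)
    (hr : ∀ i j, ∫⁻ x, ENNReal.ofReal (g i x * g j x) ∂μ ≤ ENNReal.ofReal (r i j))
    {ε : ℝ} (hε : 0 < ε) (havg : ∑ i, ∑ j, r i j ≤ (1 + ε ^ 2) * (Fintype.card ι) ^ 2)
    {A : Set X} (hA : MeasurableSet A) {α : ℝ}
    (hcov : ∀ i, ENNReal.ofReal (1 - α) ≤ ∫⁻ x in A, ENNReal.ofReal (g i x) ∂μ) :
    1 - α - ε ≤ μ.real A := by
  set N : ℝ := (Fintype.card ι : ℝ) with hN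
  have hNpos : 0 < N := by rw [hN]; exact_mod_cast Fintype.card_pos
  have hgi : ∀ i, Integrable (g i) μ := fun i => by
    refine ⟨(hg i).aestronglyMeasurable, ?_⟩
    rw [hasFiniteIntegral_iff_ofReal (ae_of_all _ (hg0 i)), hg1 i]
    exact ENNReal.one_lt_top
  have hggi : ∀ i j, Integrable (fun x => g i x * g j x) μ := fun i j => by
    refine ⟨((hg i).mul (hg j)).aestronglyMeasurable, ?_⟩
    rw [hasFiniteIntegral_iff_ofReal (ae_of_all _ fun x => mul_nonneg (hg0 i x) (hg0 j x))]
    exact (hr i j).trans_lt ENNReal.ofReal_lt_top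
  have hint1 : ∀ i, ∫ x, g i x ∂μ = 1 := fun i => by
    rw [integral_eq_lintegral_of_nonneg_ae (ae_of_all _ (hg0 i)) (hg i).aestronglyMeasurable,
      hg1 i, ENNReal.toReal_one]
  have hintr : ∀ i j, ∫ x, g i x * g j x ∂μ ≤ r i j := fun i j => by
    rw [integral_eq_lintegral_of_nonneg_ae (ae_of_all _ fun x => mul_nonneg (hg0 i x) (hg0 j x))
      ((hg i).mul (hg j)).aestronglyMeasurable]
    exact ENNReal.toReal_le_of_le_ofReal (hr0 i j) (hr i j)
  have hintA : ∀ i, 1 - α ≤ ∫ x in A, g i x ∂μ := fun i => by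
    rw [integral_eq_lintegral_of_nonneg_ae (ae_of_all _ (hg0 i)) (hg i).aestronglyMeasurable]
    refine (ENNReal.ofReal_le_iff_le_toReal ?_).1 (hcov i)
    exact ((setLIntegral_le_lintegral _ _).trans_lt (by rw [hg1 i]; exact ENNReal.one_lt_top)).ne
  set L : X → ℝ := fun x => (∑ i, g i x) / N with hL
  have hLi : Integrable L μ := (integrable_finsetSum _ fun i _ => hgi i).div_const _
  have hL2 : (fun x => L x ^ 2) = fun x => (∑ i, ∑ j, g i x * g j x) / N ^ 2 := by
    ext x; rw [hL]; simp only [div_pow, sq (∑ i, g i x), Finset.sum_mul_sum]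
  have hL2i : Integrable (fun x => L x ^ 2) μ := by
    rw [hL2]
    exact (integrable_finsetSum _ fun i _ => integrable_finsetSum _ fun j _ => hggi i j).div_const _
  have hIL : ∫ x, L x ∂μ = 1 := by
    simp only [hL]
    rw [integral_div, integral_finsetSum _ fun i _ => hgi i]
    simp only [hint1, Finset.sum_const, Finset.card_univ, nsmul_eq_mul, mul_one]
    exact div_self hNpos.ne'
  have hIL2 : ∫ x, L x ^ 2 ∂μ ≤ 1 + ε ^ 2 := by
    rw [hL2, integral_div, integral_finsetSum _ fun i _ => integrable_finsetSum _ fun j _ => hggi i j,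
      div_le_iff₀ (by positivity)]
    refine le_trans (Finset.sum_le_sum fun i _ => ?_) havg
    rw [integral_finsetSum _ fun j _ => hggi i j]
    exact Finset.sum_le_sum fun j _ => hintr i j
  have hILA : 1 - α ≤ ∫ x in A, L x ∂μ := by
    simp only [hL]
    rw [integral_div, integral_finsetSum _ fun i _ => (hgi i).integrableOn, le_div_iff₀ hNpos]
    calc (1 - α) * N = ∑ _i : ι, (1 - α) := by simp [hN]; ring
      _ ≤ _ := Finset.sum_le_sum fun i _ => hintA i
  -- On `A`, the excess `L - 1` is bounded by `((L - 1) ^ 2 / ε + ε) / 2`.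
  have hpt : ∀ x, A.indicator L x ≤ A.indicator 1 x + ((L x ^ 2 - 2 * L x + 1) / (2 * ε) + ε / 2) := by
    intro x
    have h : L x - 1 ≤ (L x ^ 2 - 2 * L x + 1) / (2 * ε) + ε / 2 := by
      rw [div_add' _ _ _ (by positivity), le_div_iff₀ (by positivity)]
      nlinarith [sq_nonneg (L x - 1 - ε)]
    by_cases hx : x ∈ A
    · simp only [Set.indicator_of_mem hx, Pi.one_apply]; linarith
    · simp only [Set.indicator_of_notMem hx]
      have : L x ^ 2 - 2 * L x + 1 = (L x - 1) ^ 2 := by ring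
      rw [this]; positivity
  have i1 : Integrable (fun x => L x ^ 2 - 2 * L x + 1) μ :=
    (hL2i.sub (hLi.const_mul 2)).add (integrable_const 1)
  have i2 : Integrable (A.indicator (1 : X → ℝ)) μ := (integrable_const (1 : ℝ)).indicator hA
  have i3 : Integrable (fun x => (L x ^ 2 - 2 * L x + 1) / (2 * ε) + ε / 2) μ :=
    (i1.div_const _).add (integrable_const _)
  have key := integral_mono (hLi.indicator hA) (i2.add i3) hpt
  have e1 : ∫ x, (L x ^ 2 - 2 * L x + 1) ∂μ = ∫ x, L x ^ 2 ∂μ - 1 := by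
    rw [integral_add (f := fun x => L x ^ 2 - 2 * L x) (g := fun _ => (1 : ℝ))
      (hL2i.sub (hLi.const_mul 2)) (integrable_const 1),
      integral_sub (f := fun x => L x ^ 2) (g := fun x => 2 * L x) hL2i (hLi.const_mul 2),
      integral_const_mul, hIL]
    simp; ring
  have e2 : ∫ x, (A.indicator 1 x + ((L x ^ 2 - 2 * L x + 1) / (2 * ε) + ε / 2)) ∂μ
      = μ.real A + ((∫ x, L x ^ 2 ∂μ - 1) / (2 * ε) + ε / 2) := by
    rw [integral_add (f := A.indicator 1) i2 i3, integral_indicator_one hA,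
      integral_add (f := fun x => (L x ^ 2 - 2 * L x + 1) / (2 * ε)) (i1.div_const _)
        (integrable_const _), integral_div, e1]
    simp
  rw [integral_indicator hA] at key
  have key := key.trans_eq e2
  have : (∫ x, L x ^ 2 ∂μ - 1) / (2 * ε) ≤ ε / 2 := by
    rw [div_le_iff₀ (by positivity)]; nlinarith
  linarith

section LeCam

open scoped RealInnerProductSpace

variable {E : Type*} [NormedAddCommGroup E] [InnerProductSpace ℝ E] [FiniteDimensional ℝ E]
  [MeasurableSpace E] [BorelSpace E]

/-- A confidence interval covering the value `T θ₀` under `θ₀` and the value `t` under each of the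
parameters `θ i` is long under `θ₀`, if the laws of the observation under `θ i` arise from the one
under `θ₀` by shears `x ↦ x + ⟪l, x⟫ u i` of a Gaussian latent variable for which the average of
`exp (2 n ⟪u i, u j⟫ ‖l‖ ^ 2)` is close to one. -/
theorem le_expectedLength_of_shear {n p : ℕ} {ι : Type*} [Fintype ι] [Nonempty ι]
    {l : E} {u : ι → E} (hlu : ∀ i, ⟪l, u i⟫ = 0) (huu : ∀ i j, 0 ≤ ⟪u i, u j⟫)
    (hul : ∀ i j, ⟪u i, u j⟫ * ‖l‖ ^ 2 ≤ 1 / 4) {ε : ℝ} (hε : 0 < ε)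
    (havg : ∑ i, ∑ j, Real.exp (n * (2 * (⟪u i, u j⟫ * ‖l‖ ^ 2))) ≤
      (1 + ε ^ 2) * (Fintype.card ι) ^ 2)
    {Φ : E → ℝ × EuclideanSpace ℝ (Fin p)} (hΦ : Measurable Φ) {θ₀ : Param p} {θ : ι → Param p}
    (h₀ : obsLaw θ₀ = (stdGaussian E).map Φ)
    (h₁ : ∀ i, obsLaw (θ i) = ((stdGaussian E).map (shear l (u i))).map Φ)
    {α : ℝ} {S : Set (Param p)} {T : EuclideanSpace ℝ (Fin p) → ℝ}
    (hθ₀ : θ₀ ∈ S) (hθ : ∀ i, θ i ∈ S) {t : ℝ} (ht : ∀ i, T (θ i).β = t)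
    {I : RandomInterval n p} (hI : I ∈ confidenceIntervals n α S T) :
    ENNReal.ofReal ((1 - 2 * α - ε) * |T θ₀.β - t|) ≤ expectedLength I θ₀ := by
  have hlow := I.measurable_lower
  have hupp := I.measurable_upper
  set cover : ℝ → Set (Data n p) := fun s => {z | I.lower z ≤ s ∧ s ≤ I.upper z} with hcover
  have hcm : ∀ s, MeasurableSet (cover s) := fun s =>
    (measurableSet_le hlow measurable_const).inter (measurableSet_le measurable_const hupp)
  set μ : Measure (Fin n → E) := Measure.pi fun _ => stdGaussian E
  set Ψ : (Fin n → E) → Data n p := fun x j => Φ (x j) with hΨ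
  have hΨm : Measurable Ψ := measurable_pi_lambda _ fun j => hΦ.comp (measurable_pi_apply j)
  have hd₀ : dataLaw n θ₀ = μ.map Ψ := by
    have : IsProbabilityMeasure ((stdGaussian E).map Φ) :=
      Measure.isProbabilityMeasure_map hΦ.aemeasurable
    rw [dataLaw, h₀, hΨ, ← Measure.pi_map_pi fun _ => hΦ.aemeasurable]
  set g : ι → (Fin n → E) → ℝ := fun i x => ∏ j, shearDensity l (u i) (x j) with hg
  have hgm : ∀ i, Measurable (g i) := fun i =>
    Finset.measurable_prod _ fun j _ => (measurable_shearDensity _ _).comp (measurable_pi_apply j)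
  have hd : ∀ i, dataLaw n (θ i) = (μ.withDensity fun x => ENNReal.ofReal (g i x)).map Ψ := by
    intro i
    have hp : IsProbabilityMeasure ((stdGaussian E).map (shear l (u i))) :=
      Measure.isProbabilityMeasure_map (by fun_prop)
    have : IsProbabilityMeasure (((stdGaussian E).map (shear l (u i))).map Φ) :=
      Measure.isProbabilityMeasure_map hΦ.aemeasurable
    rw [dataLaw, h₁ i, hΨ]
    rw [← Measure.pi_map_pi fun _ => hΦ.aemeasurable]
    congr 1
    rw [map_shear_stdGaussian (hlu i)] at hp ⊢
    rw [pi_withDensity _ _ (by fun_prop)]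
    congr 1
    ext x
    exact (ENNReal.ofReal_prod_of_nonneg fun j _ => (Real.exp_pos _).le).symm
  have hg0 : ∀ i x, 0 ≤ g i x := fun i x => Finset.prod_nonneg fun j _ => (Real.exp_pos _).le
  have hg1 : ∀ i, ∫⁻ x, ENNReal.ofReal (g i x) ∂μ = 1 := by
    intro i
    have h := measure_univ (μ := dataLaw n (θ i)) (self := by unfold dataLaw; infer_instance)
    rw [hd i, Measure.map_apply hΨm MeasurableSet.univ, Set.preimage_univ,
      withDensity_apply _ MeasurableSet.univ, Measure.restrict_univ] at h
    exact h
  have hr : ∀ i j, ∫⁻ x, ENNReal.ofReal (g i x * g j x) ∂μ ≤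
      ENNReal.ofReal (Real.exp (n * (2 * (⟪u i, u j⟫ * ‖l‖ ^ 2)))) := by
    intro i j
    have h1 : ∀ x : Fin n → E, ENNReal.ofReal (g i x * g j x) =
        ∏ m, ENNReal.ofReal (shearDensity l (u i) (x m) * shearDensity l (u j) (x m)) := by
      intro x
      rw [hg, ← Finset.prod_mul_distrib, ENNReal.ofReal_prod_of_nonneg]
      exact fun m _ => mul_nonneg (Real.exp_pos _).le (Real.exp_pos _).le
    simp_rw [h1]
    rw [lintegral_fin_prod_eq_prod (fun _ => stdGaussian E)
      (fun _ x => ENNReal.ofReal (shearDensity l (u i) x * shearDensity l (u j) x))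
      fun _ => by fun_prop]
    rw [Finset.prod_const, Finset.card_univ, Fintype.card_fin, Real.exp_nat_mul,
      ENNReal.ofReal_pow (Real.exp_pos _).le]
    gcongr
    exact lintegral_shearDensity_mul_le (hlu i) (hlu j) (huu i j) (hul i j)
  have c1 : 1 - α - ε ≤ (dataLaw n θ₀).real (cover t) := by
    have hcov : ∀ i, ENNReal.ofReal (1 - α) ≤
        ∫⁻ x in Ψ ⁻¹' cover t, ENNReal.ofReal (g i x) ∂μ := by
      intro i
      have := hI (θ i) (hθ i)
      rw [ht i] at this
      change _ ≤ dataLaw n (θ i) (cover t) at this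
      rwa [hd i, Measure.map_apply hΨm (hcm t), withDensity_apply _ (hΨm (hcm t))] at this
    have := measureReal_ge_of_mixture μ hgm hg0 hg1 (fun i j => (Real.exp_pos _).le) hr hε havg
      (hΨm (hcm t)) hcov
    rwa [hd₀, map_measureReal_apply hΨm (hcm t)]
  have : IsProbabilityMeasure (dataLaw n θ₀) := by unfold dataLaw; infer_instance
  have c0 : 1 - α ≤ (dataLaw n θ₀).real (cover (T θ₀.β)) :=
    (ENNReal.ofReal_le_iff_le_toReal (measure_ne_top _ _)).1 (hI θ₀ hθ₀)
  have hboth : 1 - 2 * α - ε ≤ (dataLaw n θ₀).real (cover (T θ₀.β) ∩ cover t) := by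
    have h1 := measureReal_union_add_inter (μ := dataLaw n θ₀) (s := cover (T θ₀.β)) (hcm t)
    have h2 : (dataLaw n θ₀).real (cover (T θ₀.β) ∪ cover t) ≤ 1 := measureReal_le_one
    linarith
  calc ENNReal.ofReal ((1 - 2 * α - ε) * |T θ₀.β - t|)
      ≤ ENNReal.ofReal ((dataLaw n θ₀).real (cover (T θ₀.β) ∩ cover t) * |T θ₀.β - t|) := by
        gcongr
    _ = ∫⁻ _z in cover (T θ₀.β) ∩ cover t, ENNReal.ofReal |T θ₀.β - t| ∂(dataLaw n θ₀) := by
        rw [setLIntegral_const, ENNReal.ofReal_mul measureReal_nonneg, ofReal_measureReal, mul_comm]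
    _ ≤ ∫⁻ z in cover (T θ₀.β) ∩ cover t, ENNReal.ofReal (I.upper z - I.lower z)
          ∂(dataLaw n θ₀) := by
        refine setLIntegral_mono (by fun_prop) fun z hz => ENNReal.ofReal_le_ofReal ?_
        obtain ⟨⟨h1, h2⟩, h3, h4⟩ := hz
        exact abs_sub_le_iff.2 ⟨by linarith, by linarith⟩
    _ ≤ expectedLength I θ₀ := setLIntegral_le_lintegral _ _

end LeCam

/-! ### The law of an observation as a linear image of a standard Gaussian -/

section Laws

open scoped RealInnerProductSpace Matrix

variable {p : ℕ}

theorem charFunDual_obsLaw (θ : Param p) (hS : (θ.Ω⁻¹).PosSemidef) (τ : ℝ)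
    (t : EuclideanSpace ℝ (Fin p)) (L : StrongDual ℝ (ℝ × EuclideanSpace ℝ (Fin p)))
    (hL : ∀ y, L y = τ * y.1 + ⟪t, y.2⟫) :
    charFunDual (obsLaw θ) L = Complex.exp (-(((t + τ • θ.β).ofLp ⬝ᵥ θ.Ω⁻¹ *ᵥ (t + τ • θ.β).ofLp
      + θ.σ ^ 2 * τ ^ 2 : ℝ) : ℂ) / 2) := by
  set A : EuclideanSpace ℝ (Fin p) × ℝ →L[ℝ] ℝ × EuclideanSpace ℝ (Fin p) :=
    ((innerSL ℝ θ.β).comp (ContinuousLinearMap.fst ℝ _ _) +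
      ContinuousLinearMap.snd ℝ _ _).prod (ContinuousLinearMap.fst ℝ _ _) with hA
  have hlaw : obsLaw θ = ((multivariateGaussian (0 : EuclideanSpace ℝ (Fin p)) θ.Ω⁻¹).prod
      (gaussianReal 0 (θ.σ ^ 2).toNNReal)).map A := by
    rw [obsLaw]
    congr 1
    ext w : 1
    simp [hA, real_inner_comm]
  have h1 : (L.comp A).comp (ContinuousLinearMap.inl ℝ _ _) =
      InnerProductSpace.toDualMap ℝ _ (t + τ • θ.β) := by
    ext x
    simp [hL, hA]
    ring
  have h2 : (L.comp A).comp (ContinuousLinearMap.inr ℝ _ _) =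
      InnerProductSpace.toDualMap ℝ ℝ τ := by
    ext
    simp [hL, hA]
  rw [hlaw, charFunDual_map, charFunDual_prod, h1, h2, ← charFun_eq_charFunDual_toDualMap,
    ← charFun_eq_charFunDual_toDualMap, charFun_multivariateGaussian hS, charFun_gaussianReal,
    ← Complex.exp_add]
  congr 1
  simp [Real.coe_toNNReal _ (sq_nonneg θ.σ)]
  ring

/-- A linear image of a standard Gaussian is the law of an observation as soon as all its
one-dimensional projections have the right variance. -/
theorem obsLaw_eq_map {E : Type*} [NormedAddCommGroup E] [InnerProductSpace ℝ E]
    [FiniteDimensional ℝ E] [MeasurableSpace E] [BorelSpace E]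
    (θ : Param p) (hS : (θ.Ω⁻¹).PosSemidef) (Φ : E →L[ℝ] ℝ × EuclideanSpace ℝ (Fin p))
    (h : ∀ (τ : ℝ) (t : EuclideanSpace ℝ (Fin p)), ∃ w : E,
      (∀ z, τ * (Φ z).1 + ⟪t, (Φ z).2⟫ = ⟪w, z⟫) ∧
      ‖w‖ ^ 2 = (t + τ • θ.β).ofLp ⬝ᵥ θ.Ω⁻¹ *ᵥ (t + τ • θ.β).ofLp + θ.σ ^ 2 * τ ^ 2) :
    obsLaw θ = (stdGaussian E).map Φ := by
  have : IsProbabilityMeasure ((stdGaussian E).map Φ) :=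
    Measure.isProbabilityMeasure_map (by fun_prop)
  refine Measure.ext_of_charFunDual (funext fun L => ?_)
  set t := (InnerProductSpace.toDual ℝ (EuclideanSpace ℝ (Fin p))).symm
    (L.comp (ContinuousLinearMap.inr ℝ _ _)) with ht
  have hL : ∀ y, L y = L (1, 0) * y.1 + ⟪t, y.2⟫ := by
    intro y
    rw [ht, InnerProductSpace.toDual_symm_apply]
    have : y = y.1 • ((1 : ℝ), (0 : EuclideanSpace ℝ (Fin p))) + (0, y.2) := by simp
    conv_lhs => rw [this]
    rw [map_add, map_smul]
    simp [mul_comm]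
  obtain ⟨w, hw, hn⟩ := h (L (1, 0)) t
  have hc : L.comp Φ = innerSL ℝ w := by
    ext z
    simp [hL (Φ z), hw]
  rw [charFunDual_obsLaw θ hS _ t L hL, charFunDual_map, hc, charFunDual_stdGaussian,
    innerSL_apply_norm, ← hn]
  push_cast
  rfl

/-- The covariance matrix of `X + a (⟪v, X⟫ + s e) u`, where `X` and `e` are standard Gaussian and
`v` is a unit vector. -/
noncomputable def shearCov (a s : ℝ) (v u : EuclideanSpace ℝ (Fin p)) :
    Matrix (Fin p) (Fin p) ℝ :=
  1 + a • (Matrix.vecMulVec v.ofLp u.ofLp + Matrix.vecMulVec u.ofLp v.ofLp) +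
    (a ^ 2 * (1 + s ^ 2)) • Matrix.vecMulVec u.ofLp u.ofLp

theorem isHermitian_shearCov (a s : ℝ) (v u : EuclideanSpace ℝ (Fin p)) :
    (shearCov a s v u).IsHermitian := by
  ext i j
  simp [shearCov, Matrix.vecMulVec_apply, Matrix.one_apply, eq_comm, mul_comm, add_comm]

theorem dotProduct_shearCov (a s : ℝ) (v u x : EuclideanSpace ℝ (Fin p)) :
    x.ofLp ⬝ᵥ shearCov a s v u *ᵥ x.ofLp =
      ‖x‖ ^ 2 + 2 * a * ⟪x, v⟫ * ⟪x, u⟫ + a ^ 2 * (1 + s ^ 2) * ⟪x, u⟫ ^ 2 := by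
  have h1 : x.ofLp ⬝ᵥ x.ofLp = ‖x‖ ^ 2 := by
    rw [← real_inner_self_eq_norm_sq, EuclideanSpace.inner_eq_star_dotProduct]; rfl
  have h2 : ∀ y : EuclideanSpace ℝ (Fin p), x.ofLp ⬝ᵥ y.ofLp = ⟪x, y⟫ := fun y => by
    rw [dotProduct_comm, EuclideanSpace.inner_eq_star_dotProduct]; rfl
  simp only [shearCov, Matrix.add_mulVec, Matrix.smul_mulVec, Matrix.one_mulVec,
    Matrix.vecMulVec_mulVec, dotProduct_add, dotProduct_smul, h1, h2 v, h2 u, smul_eq_mul,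
    op_smul_eq_smul, dotProduct_comm v.ofLp, dotProduct_comm u.ofLp]
  ring

/-- If the quadratic form of a symmetric matrix lies between `1 / M` and `M` times the square of the
norm, then the matrix is the inverse of an admissible precision matrix. -/
theorem precision_of_covariance {M : ℝ} (hM : 1 < M) {S : Matrix (Fin p) (Fin p) ℝ}
    (hS : S.IsHermitian)
    (hl : ∀ x : EuclideanSpace ℝ (Fin p), 1 / M * ‖x‖ ^ 2 ≤ x.ofLp ⬝ᵥ S *ᵥ x.ofLp)
    (hu : ∀ x : EuclideanSpace ℝ (Fin p), x.ofLp ⬝ᵥ S *ᵥ x.ofLp ≤ M * ‖x‖ ^ 2) :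
    S.PosDef ∧ (S⁻¹)⁻¹ = S ∧ ∃ h : (S⁻¹).IsHermitian,
      ∀ i, 1 / M ≤ h.eigenvalues i ∧ h.eigenvalues i ≤ M := by
  have hM0 : 0 < M := by linarith
  have hpos : S.PosDef := by
    refine Matrix.PosDef.of_dotProduct_mulVec_pos hS fun x hx => ?_
    have h := hl (WithLp.toLp 2 x)
    have : 0 < ‖WithLp.toLp 2 x‖ := by
      rw [norm_pos_iff]; simpa using hx
    refine lt_of_lt_of_le ?_ h
    positivity
  have hdet : IsUnit S.det := (Matrix.isUnit_iff_isUnit_det S).1 hpos.isUnit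
  refine ⟨hpos, Matrix.nonsing_inv_nonsing_inv S hdet, hS.inv, fun i => ?_⟩
  set lam := hS.inv.eigenvalues i with hlam
  set x := hS.inv.eigenvectorBasis i with hx
  have hx1 : ‖x‖ = 1 := hS.inv.eigenvectorBasis.orthonormal.1 i
  have hev : S⁻¹ *ᵥ x.ofLp = lam • x.ofLp := hS.inv.mulVec_eigenvectorBasis i
  have hxx : x.ofLp ⬝ᵥ x.ofLp = 1 := by
    have : ⟪x, x⟫ = 1 := by rw [real_inner_self_eq_norm_sq, hx1, one_pow]
    rw [← this, EuclideanSpace.inner_eq_star_dotProduct]; rfl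
  have hmul : lam * (x.ofLp ⬝ᵥ S *ᵥ x.ofLp) = 1 := by
    have : S *ᵥ (S⁻¹ *ᵥ x.ofLp) = x.ofLp := by
      rw [Matrix.mulVec_mulVec, Matrix.mul_nonsing_inv S hdet, Matrix.one_mulVec]
    rw [hev, Matrix.mulVec_smul] at this
    rw [← smul_eq_mul, ← dotProduct_smul, this, hxx]
  have hl' := hl x
  have hu' := hu x
  rw [hx1] at hl' hu'
  set Q := x.ofLp ⬝ᵥ S *ᵥ x.ofLp
  have hQ : 0 < Q := lt_of_lt_of_le (by positivity) hl'
  have hlamQ : lam = 1 / Q := by field_simp; linarith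
  rw [hlamQ]
  constructor
  · exact one_div_le_one_div_of_le hQ (by linarith)
  · rw [div_le_iff₀ hQ]
    have : M * (1 / M) = 1 := by field_simp
    nlinarith

/-- The covariance matrix of a sheared design is admissible if its perturbation of the identity has
small operator norm. -/
theorem precision_shearCov {M : ℝ} (hM : 1 < M) {a s : ℝ} (ha : 0 ≤ a)
    {v u : EuclideanSpace ℝ (Fin p)} (hv : ‖v‖ = 1)
    (hsmall : 2 * (a * ‖u‖) + (1 + s ^ 2) * (a * ‖u‖) ^ 2 ≤ 1 - 1 / M) :
    (shearCov a s v u).PosDef ∧ ((shearCov a s v u)⁻¹)⁻¹ = shearCov a s v u ∧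
      ∃ h : ((shearCov a s v u)⁻¹).IsHermitian,
        ∀ i, 1 / M ≤ h.eigenvalues i ∧ h.eigenvalues i ≤ M := by
  have hM0 : 0 < M := by linarith
  have hM2 : 2 ≤ M + 1 / M := by
    have : M + 1 / M - 2 = (M - 1) ^ 2 / M := by field_simp; ring
    have : 0 ≤ (M - 1) ^ 2 / M := by positivity
    linarith
  have key : ∀ x : EuclideanSpace ℝ (Fin p),
      |2 * a * ⟪x, v⟫ * ⟪x, u⟫ + a ^ 2 * (1 + s ^ 2) * ⟪x, u⟫ ^ 2| ≤ (1 - 1 / M) * ‖x‖ ^ 2 := by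
    intro x
    have h1 : |⟪x, v⟫| ≤ ‖x‖ := by simpa [hv] using abs_real_inner_le_norm x v
    have h2 : |⟪x, u⟫| ≤ ‖x‖ * ‖u‖ := abs_real_inner_le_norm x u
    calc |2 * a * ⟪x, v⟫ * ⟪x, u⟫ + a ^ 2 * (1 + s ^ 2) * ⟪x, u⟫ ^ 2|
        ≤ |2 * a * ⟪x, v⟫ * ⟪x, u⟫| + |a ^ 2 * (1 + s ^ 2) * ⟪x, u⟫ ^ 2| := abs_add_le _ _
      _ = 2 * a * |⟪x, v⟫| * |⟪x, u⟫| + a ^ 2 * (1 + s ^ 2) * |⟪x, u⟫| ^ 2 := by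
          rw [abs_mul, abs_mul, abs_mul, abs_mul, abs_of_nonneg ha, abs_pow, abs_two,
            abs_of_nonneg (by positivity : 0 ≤ a ^ 2 * (1 + s ^ 2))]
      _ ≤ 2 * a * ‖x‖ * (‖x‖ * ‖u‖) + a ^ 2 * (1 + s ^ 2) * (‖x‖ * ‖u‖) ^ 2 := by gcongr
      _ = (2 * (a * ‖u‖) + (1 + s ^ 2) * (a * ‖u‖) ^ 2) * ‖x‖ ^ 2 := by ring
      _ ≤ _ := by gcongr
  refine precision_of_covariance hM (isHermitian_shearCov a s v u) (fun x => ?_) fun x => ?_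
  · rw [dotProduct_shearCov]
    have := (abs_le.1 (key x)).1
    linarith
  · rw [dotProduct_shearCov]
    have := (abs_le.1 (key x)).2
    nlinarith [sq_nonneg ‖x‖]

theorem precision_one {M : ℝ} (hM : 1 < M) :
    ∃ h : (1 : Matrix (Fin p) (Fin p) ℝ).IsHermitian,
        ∀ i, 1 / M ≤ h.eigenvalues i ∧ h.eigenvalues i ≤ M := by
  have hx : ∀ x : EuclideanSpace ℝ (Fin p), x.ofLp ⬝ᵥ (1 : Matrix (Fin p) (Fin p) ℝ) *ᵥ x.ofLp =
      ‖x‖ ^ 2 := fun x => by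
    rw [Matrix.one_mulVec, ← real_inner_self_eq_norm_sq, EuclideanSpace.inner_eq_star_dotProduct]
    rfl
  have h := (precision_of_covariance hM (S := (1 : Matrix (Fin p) (Fin p) ℝ)) Matrix.isHermitian_one
    (fun x => ?_) fun x => ?_).2.2
  · simpa only [inv_one] using h
  · rw [hx]
    have : 1 / M ≤ 1 := by rw [div_le_one (by linarith)]; exact hM.le
    nlinarith [sq_nonneg ‖x‖]
  · rw [hx]; nlinarith [sq_nonneg ‖x‖]

/-- The space of the latent Gaussian vectors `(X, e)`: a design row and a noise variable. -/
abbrev Latent (p : ℕ) : Type := WithLp 2 (EuclideanSpace ℝ (Fin p) × ℝ)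

/-- The observation `(⟪β, X⟫ + s e, X)` as a linear function of the latent vector `(X, e)`. -/
noncomputable def observe (β : EuclideanSpace ℝ (Fin p)) (s : ℝ) :
    Latent p →L[ℝ] ℝ × EuclideanSpace ℝ (Fin p) :=
  ((innerSL ℝ β).comp (WithLp.fstL 2 ℝ _ _) + s • WithLp.sndL 2 ℝ _ _).prod (WithLp.fstL 2 ℝ _ _)

theorem observe_apply (β : EuclideanSpace ℝ (Fin p)) (s : ℝ) (z : Latent p) :
    observe β s z = (⟪β, z.fst⟫ + s * z.snd, z.fst) := by
  simp [observe]

theorem norm_toLp_sq (x : EuclideanSpace ℝ (Fin p)) (y : ℝ) :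
    ‖(WithLp.toLp 2 (x, y) : Latent p)‖ ^ 2 = ‖x‖ ^ 2 + y ^ 2 := by
  simp [WithLp.prod_norm_sq_eq_of_L2]

theorem obsLaw_one (β : EuclideanSpace ℝ (Fin p)) (s : ℝ) :
    obsLaw ⟨β, 1, s⟩ = (stdGaussian (Latent p)).map (observe β s) := by
  refine obsLaw_eq_map _ (by simpa using Matrix.PosSemidef.one) _ fun τ t => ?_
  refine ⟨WithLp.toLp 2 (t + τ • β, s * τ), fun z => ?_, ?_⟩
  · rw [observe_apply, WithLp.prod_inner_apply]
    simp [inner_add_left, inner_smul_left]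
    ring
  · rw [norm_toLp_sq, inv_one, Matrix.one_mulVec, ← real_inner_self_eq_norm_sq, EuclideanSpace.inner_eq_star_dotProduct,
      star_trivial]
    ring

/-- The linear shear as a continuous linear map. -/
noncomputable def shearCLM {E : Type*} [NormedAddCommGroup E] [InnerProductSpace ℝ E] (l u : E) :
    E →L[ℝ] E :=
  ContinuousLinearMap.id ℝ E + (innerSL ℝ l).smulRight u

/-- Shearing the design row along `u` by the multiple `a (⟪v, X⟫ + s e)` and leaving the response
as it is gives again a linear model: regressing the response on the new design moves the regression
vector along `v` by an amount independent of the direction of `u`, and decreases the noise level. -/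
theorem obsLaw_shearCov {a s b : ℝ} {v u : EuclideanSpace ℝ (Fin p)} (hv : ‖v‖ = 1)
    (hvu : ⟪v, u⟫ = 0) (hpos : (shearCov a s v u).PosDef)
    (hinv : ((shearCov a s v u)⁻¹)⁻¹ = shearCov a s v u) :
    obsLaw ⟨(b - ‖u‖ ^ 2 * a ^ 2 * s ^ 2 / (1 + ‖u‖ ^ 2 * a ^ 2 * s ^ 2)) • v +
        (a * s ^ 2 / (1 + ‖u‖ ^ 2 * a ^ 2 * s ^ 2)) • u, (shearCov a s v u)⁻¹,
        s / √(1 + ‖u‖ ^ 2 * a ^ 2 * s ^ 2)⟩ =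
      ((stdGaussian (Latent p)).map (shear (WithLp.toLp 2 (a • v, a * s)) (WithLp.toLp 2 (u, 0)))).map
        (observe (b • v) s) := by
  have hcomp : ∀ z : Latent p,
      (observe (b • v) s).comp (shearCLM (WithLp.toLp 2 (a • v, a * s)) (WithLp.toLp 2 (u, 0))) z =
      (b * ⟪v, z.fst⟫ + s * z.snd, z.fst + (a * (⟪v, z.fst⟫ + s * z.snd)) • u) := by
    intro z
    rw [ContinuousLinearMap.comp_apply, observe_apply]
    simp [shearCLM, WithLp.prod_inner_apply, inner_add_right, inner_smul_left, inner_smul_right, hvu]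
    ring_nf
  rw [Measure.map_map (by fun_prop) (by fun_prop)]
  refine obsLaw_eq_map _ (by rw [hinv]; exact hpos.posSemidef)
    ((observe (b • v) s).comp (shearCLM (WithLp.toLp 2 (a • v, a * s)) (WithLp.toLp 2 (u, 0))))
    fun τ t => ?_
  set d := ⟪t, u⟫ with hd
  refine ⟨WithLp.toLp 2 (t + (τ * b + a * d) • v, s * τ + a * s * d), fun z => ?_, ?_⟩
  · rw [hcomp, WithLp.prod_inner_apply]
    simp [inner_add_left, inner_add_right, inner_smul_left, inner_smul_right, ← hd]
    ring
  · set D := 1 + ‖u‖ ^ 2 * a ^ 2 * s ^ 2 with hD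
    have hDpos : 0 < D := by positivity
    rw [norm_toLp_sq, hinv]
    dsimp only
    rw [dotProduct_shearCov, div_pow, Real.sq_sqrt hDpos.le]
    set e := ⟪t, v⟫ with he
    have huv : ⟪u, v⟫ = 0 := by rw [real_inner_comm, hvu]
    have n1 : ∀ x y : ℝ, ‖t + τ • (x • v + y • u)‖ ^ 2 =
        ‖t‖ ^ 2 + 2 * τ * (x * e + y * d) + τ ^ 2 * (x ^ 2 + y ^ 2 * ‖u‖ ^ 2) := by
      intro x y
      rw [← real_inner_self_eq_norm_sq]
      simp only [inner_add_left, inner_add_right, inner_smul_left, inner_smul_right,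
        real_inner_self_eq_norm_sq, hv, hvu, huv, real_inner_comm t u, real_inner_comm t v, ← hd, ← he,
        conj_trivial]
      ring
    have n2 : ∀ x y : ℝ, ⟪t + τ • (x • v + y • u), v⟫ = e + τ * x := by
      intro x y
      simp [inner_add_left, inner_smul_left, hv, huv, ← he]
    have n3 : ∀ x y : ℝ, ⟪t + τ • (x • v + y • u), u⟫ = d + τ * y * ‖u‖ ^ 2 := by
      intro x y
      simp [inner_add_left, inner_smul_left, hvu, ← hd]
      ring
    have n4 : ‖t + (τ * b + a * d) • v‖ ^ 2 =
        ‖t‖ ^ 2 + 2 * (τ * b + a * d) * e + (τ * b + a * d) ^ 2 := by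
      rw [norm_add_sq_real, inner_smul_right, norm_smul, hv, mul_one, Real.norm_eq_abs, sq_abs, ← he]
      ring
    rw [n1, n2, n3, n4]
    have hN : ‖u‖ ^ 2 * a ^ 2 * s ^ 2 = D - 1 := by rw [hD]; ring
    field_simp
    rw [hD]
    ring

end Laws

/-! ### Sparse vectors and sparse loadings -/

section Sparse

open scoped RealInnerProductSpace

variable {p : ℕ}

theorem l0norm_eq_card (v : EuclideanSpace ℝ (Fin p)) :
    l0norm v = (Finset.univ.filter fun i => v i ≠ 0).card := rfl

theorem l0norm_le_of_support {v : EuclideanSpace ℝ (Fin p)} {T : Finset (Fin p)}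
    (h : ∀ i, v i ≠ 0 → i ∈ T) : l0norm v ≤ T.card := by
  rw [l0norm_eq_card]
  exact Finset.card_le_card fun i hi => h i (Finset.mem_filter.1 hi).2

theorem l0norm_smul_le (c : ℝ) (v : EuclideanSpace ℝ (Fin p)) : l0norm (c • v) ≤ l0norm v := by
  rw [l0norm_eq_card v]
  exact l0norm_le_of_support fun i hi => by
    rw [Finset.mem_filter]; exact ⟨Finset.mem_univ _, fun h => hi (by simp [h])⟩

theorem l0norm_add_le (v w : EuclideanSpace ℝ (Fin p)) : l0norm (v + w) ≤ l0norm v + l0norm w := by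
  rw [l0norm_eq_card v, l0norm_eq_card w]
  refine (l0norm_le_of_support fun i hi => ?_).trans (Finset.card_union_le _ _)
  simp only [Finset.mem_union, Finset.mem_filter, Finset.mem_univ, true_and]
  by_contra! h
  exact hi (by simp [h.1, h.2])

theorem l0norm_zero : l0norm (0 : EuclideanSpace ℝ (Fin p)) = 0 := by simp [l0norm]

/-- Restricting a loading with comparable coordinates to `t` of its `q` nonzero coordinates keeps
a fraction of order `√(t / q)` of its norm. -/
theorem exists_sparse_direction {q t : ℕ} {cbar : ℝ} (hcbar : 1 ≤ cbar)
    {ξ : EuclideanSpace ℝ (Fin p)} (hξ : ξ ∈ Xi p q cbar) (ht : 1 ≤ t) (htq : t ≤ q) :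
    ∃ v : EuclideanSpace ℝ (Fin p), ‖v‖ = 1 ∧ l0norm v ≤ t ∧ (∀ i, ξ i = 0 → v i = 0) ∧
      √(t / q) / cbar * ‖ξ‖ ≤ ⟪ξ, v⟫ := by
  obtain ⟨hq, -, hratio⟩ := hξ
  set F : Finset (Fin p) := Finset.univ.filter fun i => ξ i ≠ 0 with hF
  have hFq : F.card = q := by rw [← hq, l0norm_eq_card]
  obtain ⟨T, hTF, hTt⟩ := Finset.exists_subset_card_eq (htq.trans hFq.ge)
  have hT : ∀ i ∈ T, ξ i ≠ 0 := fun i hi => (Finset.mem_filter.1 (hTF hi)).2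
  set w : EuclideanSpace ℝ (Fin p) := WithLp.toLp 2 fun i => if i ∈ T then ξ i else 0 with hw
  have hw2 : ‖w‖ ^ 2 = ∑ i ∈ T, ξ i ^ 2 := by
    simp [EuclideanSpace.real_norm_sq_eq, hw, ite_pow, Finset.sum_ite_mem]
  have hξ2 : ‖ξ‖ ^ 2 = ∑ i ∈ F, ξ i ^ 2 := by
    rw [EuclideanSpace.real_norm_sq_eq, hF, Finset.sum_filter_of_ne]
    intro i _ hi h
    simp [h] at hi
  have hξw : ⟪ξ, w⟫ = ‖w‖ ^ 2 := by
    rw [hw2]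
    simp [PiLp.inner_apply, hw, Finset.sum_ite_mem, sq]
  have hwpos : 0 < ‖w‖ ^ 2 := by
    rw [hw2]
    refine Finset.sum_pos (fun i hi => by have := hT i hi; positivity) ?_
    rw [← Finset.card_pos]; omega
  have hwne : 0 < ‖w‖ := by
    rcases (norm_nonneg w).lt_or_eq with h | h
    · exact h
    · rw [← h] at hwpos; norm_num at hwpos
  have hcmp : (t : ℝ) * ‖ξ‖ ^ 2 ≤ cbar ^ 2 * (q * ‖w‖ ^ 2) := by
    have h1 : ∑ i ∈ T, ∑ j ∈ F, ξ j ^ 2 ≤ ∑ i ∈ T, ∑ _j ∈ F, cbar ^ 2 * ξ i ^ 2 := by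
      refine Finset.sum_le_sum fun i hi => Finset.sum_le_sum fun j hj => ?_
      have h := hratio j i (Finset.mem_filter.1 hj).2 (hT i hi)
      rw [div_le_iff₀ (abs_pos.2 (hT i hi))] at h
      calc ξ j ^ 2 = |ξ j| ^ 2 := (sq_abs _).symm
        _ ≤ (cbar * |ξ i|) ^ 2 := by gcongr
        _ = cbar ^ 2 * ξ i ^ 2 := by rw [mul_pow, sq_abs]
    rw [Finset.sum_const, nsmul_eq_mul, hTt, ← hξ2] at h1
    refine h1.trans (le_of_eq ?_)
    simp_rw [Finset.sum_const, nsmul_eq_mul, hFq]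
    rw [hw2, Finset.mul_sum, Finset.mul_sum]
    exact Finset.sum_congr rfl fun i _ => by ring
  refine ⟨‖w‖⁻¹ • w, ?_, ?_, ?_, ?_⟩
  · rw [norm_smul, norm_inv, norm_norm, inv_mul_cancel₀ hwne.ne']
  · refine (l0norm_smul_le _ _).trans (hTt ▸ l0norm_le_of_support fun i hi => ?_)
    by_contra h
    exact hi (by simp [hw, h])
  · intro i hi
    have : w i = 0 := by simp [hw, hi]
    simp [this]
  · rw [inner_smul_right, hξw, sq, inv_mul_cancel_left₀ hwne.ne']
    have hq0 : (0 : ℝ) < q := by exact_mod_cast ht.trans htq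
    have hc0 : 0 < cbar := by linarith
    refine le_of_sq_le_sq ?_ hwne.le
    rw [mul_pow, div_pow, Real.sq_sqrt (by positivity)]
    rw [div_div, div_mul_eq_mul_div, div_le_iff₀ (by positivity)]
    linarith

end Sparse

/-! ### Block-structured sparse directions -/

section Blocks

open scoped RealInnerProductSpace

variable {p m B : ℕ}

/-- The indicator vector of the `m` coordinates `g (i, f i)`, one from each of `m` blocks of `B`
coordinates. -/
noncomputable def blockVec (g : Fin m × Fin B ↪ Fin p) (f : Fin m → Fin B) :
    EuclideanSpace ℝ (Fin p) :=
  ∑ i, EuclideanSpace.single (g (i, f i)) (1 : ℝ)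

theorem blockVec_apply_ne_zero {g : Fin m × Fin B ↪ Fin p} {f : Fin m → Fin B} {j : Fin p}
    (h : blockVec g f j ≠ 0) : ∃ i, j = g (i, f i) := by
  by_contra! hj
  refine h ?_
  simp only [blockVec, WithLp.ofLp_sum, Finset.sum_apply]
  exact Finset.sum_eq_zero fun i _ => by simp [hj i]

theorem l0norm_blockVec_le (g : Fin m × Fin B ↪ Fin p) (f : Fin m → Fin B) :
    l0norm (blockVec g f) ≤ m := by
  refine (l0norm_le_of_support (T := Finset.univ.image fun i => g (i, f i)) fun j hj => ?_).trans
    (Finset.card_image_le.trans (by simp))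
  obtain ⟨i, rfl⟩ := blockVec_apply_ne_zero hj
  exact Finset.mem_image_of_mem _ (Finset.mem_univ i)

theorem inner_blockVec_eq_zero {g : Fin m × Fin B ↪ Fin p} {v : EuclideanSpace ℝ (Fin p)}
    (hv : ∀ x, v (g x) = 0) (f : Fin m → Fin B) : ⟪v, blockVec g f⟫ = 0 := by
  simp [blockVec, inner_sum, EuclideanSpace.inner_single_right, hv]

theorem inner_blockVec (g : Fin m × Fin B ↪ Fin p) (f f' : Fin m → Fin B) :
    ⟪blockVec g f, blockVec g f'⟫ = ∑ i, if f i = f' i then (1 : ℝ) else 0 := by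
  simp only [blockVec, sum_inner, inner_sum, EuclideanSpace.inner_single_left, map_one, one_mul,
    PiLp.single_apply, g.injective.eq_iff, Prod.mk.injEq]
  refine Finset.sum_congr rfl fun i _ => ?_
  rw [Finset.sum_eq_single i]
  · simp
  · intro j _ hj; simp [hj]
  · simp

theorem norm_blockVec_sq (g : Fin m × Fin B ↪ Fin p) (f : Fin m → Fin B) :
    ‖blockVec g f‖ ^ 2 = m := by
  rw [← real_inner_self_eq_norm_sq, inner_blockVec]; simp

theorem inner_blockVec_le (g : Fin m × Fin B ↪ Fin p) (f f' : Fin m → Fin B) :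
    ⟪blockVec g f, blockVec g f'⟫ ≤ m := by
  rw [inner_blockVec]
  calc _ ≤ ∑ _i : Fin m, (1 : ℝ) := Finset.sum_le_sum fun i _ => by split_ifs <;> norm_num
    _ = m := by simp

theorem inner_blockVec_nonneg (g : Fin m × Fin B ↪ Fin p) (f f' : Fin m → Fin B) :
    0 ≤ ⟪blockVec g f, blockVec g f'⟫ := by
  rw [inner_blockVec]
  exact Finset.sum_nonneg fun i _ => by split_ifs <;> norm_num

/-- For independent uniform choices in the blocks, the exponential moment of the size of the
overlap factorizes over the blocks. -/
theorem sum_exp_inner_blockVec (g : Fin m × Fin B ↪ Fin p) (x : ℝ) :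
    ∑ f, ∑ f', Real.exp (x * ⟪blockVec g f, blockVec g f'⟫) =
      (B : ℝ) ^ m * (B - 1 + Real.exp x) ^ m := by
  have h1 : ∀ f : Fin m → Fin B, ∑ f', Real.exp (x * ⟪blockVec g f, blockVec g f'⟫) =
      (B - 1 + Real.exp x) ^ m := by
    intro f
    have h2 : ∀ f' : Fin m → Fin B, Real.exp (x * ⟪blockVec g f, blockVec g f'⟫) =
        ∏ i, if f i = f' i then Real.exp x else 1 := by
      intro f'
      rw [inner_blockVec, Finset.mul_sum, Real.exp_sum]
      refine Finset.prod_congr rfl fun i _ => ?_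
      split_ifs <;> simp
    simp_rw [h2]
    rw [← Fintype.prod_sum fun (i : Fin m) (b : Fin B) => if f i = b then Real.exp x else (1 : ℝ)]
    have h3 : ∀ i, ∑ b : Fin B, (if f i = b then Real.exp x else (1 : ℝ)) = B - 1 + Real.exp x := by
      intro i
      have h4 : ∀ b : Fin B, (if f i = b then Real.exp x else (1 : ℝ)) =
          1 + if f i = b then Real.exp x - 1 else 0 := fun b => by split_ifs <;> ring
      simp_rw [h4, Finset.sum_add_distrib]
      simp; ring
    simp [h3]
  simp [h1]

theorem avg_exp_inner_blockVec_le (hB : 1 ≤ B) (g : Fin m × Fin B ↪ Fin p) {x y : ℝ}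
    (h : Real.exp (m * (Real.exp x / B)) ≤ y) :
    ∑ f, ∑ f', Real.exp (x * ⟪blockVec g f, blockVec g f'⟫) ≤
      y * (Fintype.card (Fin m → Fin B)) ^ 2 := by
  have hB0 : (0 : ℝ) < B := by exact_mod_cast hB
  have hB1 : (1 : ℝ) ≤ B := by exact_mod_cast hB
  rw [sum_exp_inner_blockVec]
  have h1 : (B - 1 + Real.exp x : ℝ) ≤ B * Real.exp (Real.exp x / B) := by
    have h2 := Real.add_one_le_exp (Real.exp x / B)
    calc (B - 1 + Real.exp x : ℝ) ≤ B * (Real.exp x / B + 1) := by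
          rw [mul_add, mul_div_cancel₀ _ hB0.ne']; linarith
      _ ≤ _ := by gcongr
  calc (B : ℝ) ^ m * (B - 1 + Real.exp x) ^ m
      ≤ (B : ℝ) ^ m * (B * Real.exp (Real.exp x / B)) ^ m := by
        have : (0 : ℝ) ≤ B - 1 + Real.exp x := by have := Real.exp_pos x; linarith
        gcongr
    _ = Real.exp (m * (Real.exp x / B)) * ((B : ℝ) ^ m) ^ 2 := by
        rw [mul_pow, ← Real.exp_nat_mul]; ring
    _ ≤ y * ((B : ℝ) ^ m) ^ 2 := by gcongr
    _ = _ := by simp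

end Blocks

/-! ### Two lower bounds for the expected length -/

section LowerBounds

open scoped RealInnerProductSpace

variable {p : ℕ}

theorem mem_Theta_one {M₁ M₂ s : ℝ} (hM₁ : 1 < M₁) (hs : 0 < s) (hsM : s ≤ M₂) {k : ℕ}
    {β : EuclideanSpace ℝ (Fin p)} (hβ : l0norm β ≤ k) : (⟨β, 1, s⟩ : Param p) ∈ Theta M₁ M₂ p k :=
  ⟨hβ, precision_one hM₁, hs, hsM⟩

/-- The parametric lower bound: the regression vectors `0` and `(s δ) v` cannot be told apart when
`n δ ^ 2` is small. -/
theorem le_expectedLength_parametric {M₁ M₂ s α ε δ : ℝ} (hM₁ : 1 < M₁) (hs : 0 < s) (hsM : s ≤ M₂)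
    (hε : 0 < ε) (hδ : 0 ≤ δ) (hδ1 : δ ^ 2 ≤ 1 / 4) {n k : ℕ}
    (hn : Real.exp (n * (2 * δ ^ 2)) ≤ 1 + ε ^ 2)
    {v ξ : EuclideanSpace ℝ (Fin p)} (hv : ‖v‖ = 1) (hvk : l0norm v ≤ k) {I : RandomInterval n p}
    (hI : I ∈ confidenceIntervals n α (Theta M₁ M₂ p k) fun β => inner ℝ ξ β) :
    ENNReal.ofReal ((1 - 2 * α - ε) * (s * δ * |⟪ξ, v⟫|)) ≤ expectedLength I ⟨0, 1, s⟩ := by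
  set l : Latent p := WithLp.toLp 2 (δ • v, 0) with hl
  set u : Latent p := WithLp.toLp 2 (0, 1) with hu
  have hu2 : ⟪u, u⟫ = 1 := by
    rw [real_inner_self_eq_norm_sq, hu, norm_toLp_sq]; simp
  have hl2 : ‖l‖ ^ 2 = δ ^ 2 := by
    rw [hl, norm_toLp_sq, norm_smul, hv, Real.norm_of_nonneg hδ]; simp
  have key := le_expectedLength_of_shear (n := n) (ι := Unit) (l := l) (u := fun _ => u) (ε := ε)
    (Φ := observe 0 s) (θ₀ := ⟨0, 1, s⟩) (θ := fun _ => ⟨(s * δ) • v, 1, s⟩) (α := α)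
    (S := Theta M₁ M₂ p k) (T := fun β => inner ℝ ξ β) (t := inner ℝ ξ ((s * δ) • v)) (I := I)
    (fun _ => by simp [hl, hu, WithLp.prod_inner_apply])
    (fun _ _ => by rw [hu2]; exact zero_le_one)
    (fun _ _ => by rw [hu2, hl2, one_mul]; exact hδ1) hε
    (by simp only [hu2, hl2, one_mul]; simpa using hn) (by fun_prop) (obsLaw_one 0 s)
    (fun _ => by
      rw [obsLaw_one, Measure.map_map (by fun_prop) (by fun_prop)]
      congr 1
      ext z : 1
      rw [Function.comp_apply, observe_apply, observe_apply]
      simp [shear, hl, hu, WithLp.prod_inner_apply, inner_smul_left]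
      ring)
    (mem_Theta_one hM₁ hs hsM (by simp [l0norm_zero]))
    (fun _ => mem_Theta_one hM₁ hs hsM ((l0norm_smul_le _ _).trans hvk)) (fun _ => rfl) hI
  refine le_trans (le_of_eq ?_) key
  simp only [inner_zero_right, zero_sub, abs_neg, inner_smul_right, abs_mul, abs_of_pos hs,
    abs_of_nonneg hδ]

/-- The high-dimensional lower bound: a null model with an isotropic design cannot be told apart
from the mixture of the models in which `m` unknown coordinates of the design, one from each of `m`
blocks of size `B`, are correlated with the direction `v` and with the noise. -/
theorem le_expectedLength_mixture {M₁ M₂ s α ε a b : ℝ} (hM₁ : 1 < M₁) (hs : 0 < s) (hsM : s ≤ M₂)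
    (hε : 0 < ε) (ha : 0 ≤ a) {n k m B : ℕ} (hB : 1 ≤ B) (hm4 : m * (a ^ 2 * (1 + s ^ 2)) ≤ 1 / 4)
    (hsmall : 2 * (a * √m) + (1 + s ^ 2) * (a * √m) ^ 2 ≤ 1 - 1 / M₁)
    (hchi : Real.exp (m * (Real.exp (n * (2 * (a ^ 2 * (1 + s ^ 2)))) / B)) ≤ 1 + ε ^ 2)
    {v ξ : EuclideanSpace ℝ (Fin p)} (hv : ‖v‖ = 1) {g : Fin m × Fin B ↪ Fin p}
    (hvg : ∀ x, v (g x) = 0) (hξg : ∀ x, ξ (g x) = 0) (hbk : l0norm (b • v) ≤ k)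
    (hk : l0norm ((b - m * a ^ 2 * s ^ 2 / (1 + m * a ^ 2 * s ^ 2)) • v) + m ≤ k)
    {I : RandomInterval n p}
    (hI : I ∈ confidenceIntervals n α (Theta M₁ M₂ p k) fun β => inner ℝ ξ β) :
    ENNReal.ofReal ((1 - 2 * α - ε) *
      (m * a ^ 2 * s ^ 2 / (1 + m * a ^ 2 * s ^ 2) * |⟪ξ, v⟫|)) ≤ expectedLength I ⟨b • v, 1, s⟩ := by
  have hBne : Nonempty (Fin B) := ⟨⟨0, hB⟩⟩
  set Δ := m * a ^ 2 * s ^ 2 / (1 + m * a ^ 2 * s ^ 2) with hΔ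
  have hΔ0 : 0 ≤ Δ := by positivity
  set ρ := a * s ^ 2 / (1 + m * a ^ 2 * s ^ 2) with hρ
  set l : Latent p := WithLp.toLp 2 (a • v, a * s) with hl
  set u : (Fin m → Fin B) → Latent p := fun f => WithLp.toLp 2 (blockVec g f, 0) with hu
  have hnorm : ∀ f, ‖blockVec g f‖ = √m := fun f => by
    rw [← norm_blockVec_sq g f, Real.sqrt_sq (norm_nonneg _)]
  have huu : ∀ f f', ⟪u f, u f'⟫ = ⟪blockVec g f, blockVec g f'⟫ := fun f f' => by
    simp [hu, WithLp.prod_inner_apply]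
  have hl2 : ‖l‖ ^ 2 = a ^ 2 * (1 + s ^ 2) := by
    rw [hl, norm_toLp_sq, norm_smul, hv, Real.norm_of_nonneg ha]; ring
  have hcov : ∀ f, _ := fun f =>
    precision_shearCov (s := s) hM₁ ha (u := blockVec g f) hv (by rw [hnorm f]; exact hsmall)
  have hobs : ∀ f, obsLaw ⟨(b - Δ) • v + ρ • blockVec g f, (shearCov a s v (blockVec g f))⁻¹,
      s / √(1 + m * a ^ 2 * s ^ 2)⟩ =
      ((stdGaussian (Latent p)).map (shear l (u f))).map (observe (b • v) s) := fun f => by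
    have := obsLaw_shearCov (a := a) (s := s) (b := b) hv (inner_blockVec_eq_zero hvg f) (hcov f).1
      (hcov f).2.1
    rwa [norm_blockVec_sq] at this
  have hsqrt : 1 ≤ √(1 + m * a ^ 2 * s ^ 2) := by
    rw [Real.one_le_sqrt]
    have : 0 ≤ m * a ^ 2 * s ^ 2 := by positivity
    linarith
  have key := le_expectedLength_of_shear (n := n) (ε := ε) (l := l) (u := u)
    (Φ := observe (b • v) s) (θ₀ := ⟨b • v, 1, s⟩)
    (θ := fun f => ⟨(b - Δ) • v + ρ • blockVec g f, (shearCov a s v (blockVec g f))⁻¹,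
      s / √(1 + m * a ^ 2 * s ^ 2)⟩) (α := α)
    (S := Theta M₁ M₂ p k) (T := fun β => inner ℝ ξ β) (t := inner ℝ ξ ((b - Δ) • v)) (I := I)
    (fun f => by
      simp [hl, hu, WithLp.prod_inner_apply, inner_smul_left, inner_blockVec_eq_zero hvg f])
    (fun f f' => by rw [huu]; exact inner_blockVec_nonneg g f f')
    (fun f f' => by
      rw [huu, hl2]
      refine le_trans ?_ hm4
      gcongr
      exact inner_blockVec_le g f f') hε
    (by
      have := avg_exp_inner_blockVec_le hB g hchi
      refine le_trans (le_of_eq ?_) this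
      refine Finset.sum_congr rfl fun f _ => Finset.sum_congr rfl fun f' _ => ?_
      rw [huu, hl2]
      congr 1; ring)
    (by fun_prop) (obsLaw_one _ s) hobs (mem_Theta_one hM₁ hs hsM hbk)
    (fun f => ⟨(l0norm_add_le _ _).trans ((Nat.add_le_add_left
        ((l0norm_smul_le _ _).trans (l0norm_blockVec_le g f)) _).trans hk),
      (hcov f).2.2, by positivity, (div_le_self hs.le hsqrt).trans hsM⟩)
    (fun f => by
      simp [inner_add_right, inner_smul_right, inner_blockVec_eq_zero hξg f]) hI
  refine le_trans (le_of_eq ?_) key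
  have : (inner ℝ ξ (b • v) - inner ℝ ξ ((b - Δ) • v) : ℝ) = Δ * ⟪ξ, v⟫ := by
    rw [inner_smul_right, inner_smul_right]; ring
  simp only [this, abs_mul, abs_of_nonneg hΔ0]

end LowerBounds

/-! ### Uniform lower bounds over the regime of the sparsity levels -/

section Regime

open scoped RealInnerProductSpace

theorem expectedLength_le_maxExpectedLength {n p : ℕ} {I : RandomInterval n p} {S : Set (Param p)}
    {θ : Param p} (h : θ ∈ S) : expectedLength I θ ≤ maxExpectedLength I S :=
  le_iSup₂ (f := fun θ (_ : θ ∈ S) => expectedLength I θ) θ h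

/-- The number of coordinates of the loading along which the regression vector is moved; about half
of the sparsity `k` is kept for the other coordinates. -/
def directionSize (q k : ℕ) : ℕ := min q (max 1 (k / 2))

theorem exists_direction {p q k : ℕ} {C cbar : ℝ} (hC : 0 < C) (hcbar : 1 ≤ cbar)
    {ξ : EuclideanSpace ℝ (Fin p)} (hξ : ξ ∈ Xi p q cbar) (hk : 1 ≤ k) (hq : 1 ≤ q)
    (hqk : (q : ℝ) ≤ C * k) :
    ∃ v : EuclideanSpace ℝ (Fin p), ‖v‖ = 1 ∧ l0norm v ≤ directionSize q k ∧
      (∀ i, ξ i = 0 → v i = 0) ∧ √(min 1 (1 / (3 * C))) / cbar * ‖ξ‖ ≤ |⟪ξ, v⟫| := by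
  obtain ⟨v, hv, hv0, hvξ, hle⟩ := exists_sparse_direction (t := directionSize q k) hcbar hξ
    (by unfold directionSize; omega) (min_le_left _ _)
  refine ⟨v, hv, hv0, hvξ, le_trans ?_ (hle.trans (le_abs_self _))⟩
  have hq0 : (0 : ℝ) < q := by exact_mod_cast hq
  gcongr
  rcases le_total q (max 1 (k / 2)) with h | h
  · rw [directionSize, min_eq_left h, div_self hq0.ne']
    exact min_le_left _ _
  · refine (min_le_right _ _).trans ?_
    rw [directionSize, min_eq_right h, div_le_div_iff₀ (by positivity) hq0, one_mul]
    have h3 : k ≤ 3 * max 1 (k / 2) := by omega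
    have h3' : (k : ℝ) ≤ 3 * (max 1 (k / 2) : ℕ) := by exact_mod_cast h3
    calc (q : ℝ) ≤ C * k := hqk
      _ ≤ C * (3 * (max 1 (k / 2) : ℕ)) := by gcongr
      _ = _ := by ring

theorem one_le_of_mem_Xi {p q : ℕ} {cbar : ℝ} {ξ : EuclideanSpace ℝ (Fin p)} (hξ : ξ ∈ Xi p q cbar) :
    1 ≤ q := by
  obtain ⟨hq, hne, -⟩ := hξ
  rw [Nat.one_le_iff_ne_zero, ← hq, l0norm, hammingNorm_ne_zero_iff]
  intro h
  exact hne (by ext i; simp [h])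

/-- The term `‖ξ‖ / √n` of the rate, over all sizes. The null model is `β = 0`, so that `k₁` may be
zero. -/
theorem parametric_rate {α M₁ M₂ C cbar : ℝ} (hα : α < 1 / 2) (hM₁ : 1 < M₁) (hM₂ : 0 < M₂)
    (hC : 0 < C) (hcbar : 1 ≤ cbar) :
    ∃ A : ℝ, 0 < A ∧ ∀ (n p k₁ k q : ℕ) (ξ : EuclideanSpace ℝ (Fin p)), 1 ≤ n → 1 ≤ k →
      (q : ℝ) ≤ C * k → ξ ∈ Xi p q cbar →
      ∀ I ∈ confidenceIntervals n α (Theta M₁ M₂ p k) (fun β => inner ℝ ξ β),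
        ENNReal.ofReal (A * (‖ξ‖ * (1 / √n))) ≤ maxExpectedLength I (Theta M₁ M₂ p k₁) := by
  set ε := (1 - 2 * α) / 2 with hε
  have hε0 : 0 < ε := by rw [hε]; linarith
  set κ := min (1 / 4) (Real.log (1 + ε ^ 2) / 2) with hκ
  have hlog : 0 < Real.log (1 + ε ^ 2) := Real.log_pos (by nlinarith)
  have hκ0 : 0 < κ := lt_min (by norm_num) (by linarith)
  set ω := √(min 1 (1 / (3 * C))) / cbar with hω
  have hω0 : 0 < ω := div_pos (Real.sqrt_pos.2 (lt_min one_pos (by positivity))) (by linarith)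
  refine ⟨ε * (M₂ * √κ * ω), by positivity, ?_⟩
  intro n p k₁ k q ξ hn hk hqk hξ I hI
  have hq := one_le_of_mem_Xi hξ
  obtain ⟨v, hv, hv0, -, hle⟩ := exists_direction hC hcbar hξ hk hq hqk
  have hn0 : (0 : ℝ) < n := by exact_mod_cast hn
  have hn1 : (1 : ℝ) ≤ n := by exact_mod_cast hn
  have hδ2 : √(κ / n) ^ 2 = κ / n := Real.sq_sqrt (by positivity)
  have h := le_expectedLength_parametric (α := α) (δ := √(κ / n)) hM₁ hM₂ le_rfl hε0
    (Real.sqrt_nonneg _)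
    (by rw [hδ2]; exact (div_le_self hκ0.le hn1).trans (min_le_left _ _))
    (n := n) (k := k) (by
      rw [hδ2, ← Real.le_log_iff_exp_le (by positivity)]
      have h1 : κ ≤ Real.log (1 + ε ^ 2) / 2 := min_le_right _ _
      have h2 : (n : ℝ) * (2 * (κ / n)) = 2 * κ := by field_simp
      linarith) hv (hv0.trans (by unfold directionSize; omega)) hI
  refine (le_trans (ENNReal.ofReal_le_ofReal ?_) h).trans
    (expectedLength_le_maxExpectedLength (mem_Theta_one hM₁ hM₂ le_rfl (by simp [l0norm_zero])))
  have e1 : 1 - 2 * α - ε = ε := by rw [hε]; ring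
  rw [e1, Real.sqrt_div hκ0.le]
  calc ε * (M₂ * √κ * ω) * (‖ξ‖ * (1 / √n)) = ε * (M₂ * (√κ / √n) * (ω * ‖ξ‖)) := by ring
    _ ≤ _ := by gcongr

theorem eventually_mul_rpow_le {γ : ℝ} (hγ : γ < 1) (D : ℝ) :
    ∀ᶠ p : ℕ in atTop, D * (p : ℝ) ^ γ ≤ p := by
  have h := ((tendsto_rpow_neg_atTop (sub_pos.2 hγ)).const_mul D).comp
    (tendsto_natCast_atTop_atTop (R := ℝ))
  rw [mul_zero] at h
  filter_upwards [h.eventually (gt_mem_nhds one_pos), eventually_gt_atTop 0] with p hp hp0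
  have hp0' : (0 : ℝ) < p := by exact_mod_cast hp0
  have e : (p : ℝ) ^ γ = (p : ℝ) ^ (-(1 - γ)) * p := by
    rw [← Real.rpow_add_one hp0'.ne']; congr 1; ring
  rw [e, ← mul_assoc]
  exact mul_le_of_le_one_left hp0'.le (le_of_lt hp)

theorem eventually_mul_rpow_neg_le {κ : ℝ} (hκ : 0 < κ) (D : ℝ) {E : ℝ} (hE : 0 < E) :
    ∀ᶠ p : ℕ in atTop, D * (p : ℝ) ^ (-κ) ≤ E := by
  have h := ((tendsto_rpow_neg_atTop hκ).const_mul D).comp (tendsto_natCast_atTop_atTop (R := ℝ))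
  rw [mul_zero] at h
  filter_upwards [h.eventually (gt_mem_nhds hE)] with p hp using le_of_lt hp

/-- Disjoint blocks of coordinates outside the support of a sparse vector. -/
theorem exists_blocks {p q m : ℕ} {ξ : EuclideanSpace ℝ (Fin p)} (hξ : l0norm ξ = q) :
    ∃ g : Fin m × Fin ((p - q) / m) ↪ Fin p, ∀ x, ξ (g x) = 0 := by
  have hcard : Fintype.card {i : Fin p // ξ i = 0} = p - q := by
    have h := Fintype.card_subtype_compl fun i : Fin p => ξ i ≠ 0
    rw [Fintype.card_fin, Fintype.card_subtype fun i : Fin p => ξ i ≠ 0, ← l0norm_eq_card, hξ] at h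
    rw [← h]
    exact Fintype.card_congr (Equiv.subtypeEquivRight fun i => by simp)
  obtain ⟨e⟩ := Function.Embedding.nonempty_of_card_le
    (α := Fin m × Fin ((p - q) / m)) (β := {i : Fin p // ξ i = 0}) (by
      rw [hcard, Fintype.card_prod, Fintype.card_fin, Fintype.card_fin]
      exact Nat.mul_div_le _ _)
  exact ⟨e.trans (Function.Embedding.subtype _), fun x => (e x).2⟩

/-- The block size left over by `q` and `m` at most fractions of `p` is of order `p / m`. -/
theorem div_four_le_block {p q m : ℕ} (hm : 1 ≤ m) (hqp : 2 * q ≤ p) (hmp : 4 * m ≤ p) :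
    (p : ℝ) / (4 * m) ≤ ((p - q) / m : ℕ) := by
  set B := (p - q) / m with hB
  have h1 : p - q < m * (B + 1) := by
    rw [hB]; exact Nat.lt_mul_div_succ _ hm
  have h2 : p ≤ 4 * (m * B) := by
    have : m * (B + 1) = m * B + m := by ring
    omega
  have hm0 : (0 : ℝ) < m := by exact_mod_cast hm
  rw [div_le_iff₀ (by positivity)]
  have h3 : (p : ℝ) ≤ 4 * (m * B) := by exact_mod_cast h2
  linarith

/-- The strength `κ` of the correlations: they respect the bounds on the eigenvalues, and the loss
`p ^ (2 κ G)` in the second moment is at most `p ^ κ'`. -/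
theorem exists_correlation_strength {c G η κ' : ℝ} (hc : 0 < c) (hG : 0 < G) (hη : 0 < η)
    (hκ' : 0 < κ') :
    ∃ κ : ℝ, 0 < κ ∧ κ * c * G ≤ 1 / 4 ∧ κ * c ≤ η ^ 2 ∧ 2 * κ * G ≤ κ' := by
  refine ⟨min (1 / (4 * c * G)) (min (η ^ 2 / c) (κ' / (2 * G))), by positivity, ?_, ?_, ?_⟩
  · calc _ ≤ 1 / (4 * c * G) * c * G := by gcongr; exact min_le_left _ _
      _ = 1 / 4 := by field_simp
  · calc _ ≤ η ^ 2 / c * c := by gcongr; exact (min_le_right _ _).trans (min_le_left _ _)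
      _ = _ := by field_simp
  · calc _ ≤ 2 * (κ' / (2 * G)) * G := by
          gcongr; exact (min_le_right _ _).trans (min_le_right _ _)
      _ = _ := by field_simp

/-- The sparsity splits into the direction `v` and at least `k / 2` further coordinates. With `b`
equal to `0` the null model is the zero vector; with `b` equal to the shift `Δ` the alternatives do
not involve `v`, which makes room for a one-sparse alternative to a one-sparse null model. -/
theorem exists_split {p q k₁ k : ℕ} (hk : 1 ≤ k) (hor : 1 ≤ k₁ ∨ 2 ≤ k)
    {v : EuclideanSpace ℝ (Fin p)} (hv : l0norm v ≤ directionSize q k) :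
    ∃ m : ℕ, 1 ≤ m ∧ m ≤ k ∧ k ≤ 2 * m ∧ ∀ Δ : ℝ, ∃ b : ℝ,
      l0norm (b • v) ≤ k₁ ∧ l0norm ((b - Δ) • v) + m ≤ k := by
  rcases Nat.lt_or_ge k 2 with h2 | h2
  · have hv1 : l0norm v ≤ 1 := hv.trans (by unfold directionSize; omega)
    refine ⟨1, le_rfl, by omega, by omega, fun Δ => ⟨Δ, ?_, ?_⟩⟩
    · exact (l0norm_smul_le _ _).trans (hv1.trans (by omega))
    · rw [sub_self, zero_smul, l0norm_zero]; omega
  · have ht : directionSize q k ≤ k / 2 := by unfold directionSize; omega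
    refine ⟨k - directionSize q k, by omega, by omega, by omega, fun Δ => ⟨0, ?_, ?_⟩⟩
    · rw [zero_smul, l0norm_zero]; omega
    · have := (l0norm_smul_le (0 - Δ) v).trans hv
      omega

/-- The second moment of the mixture is close to one: the number of blocks is at most of order
`p ^ γ`, and the block size of order `p / m`. -/
theorem block_moment_le {c γ κ' E R : ℝ} {m B p : ℕ} (hp : 1 ≤ p) (hm : 1 ≤ m)
    (hκ' : κ' = (1 - 2 * γ) / 2) (hmp : (m : ℝ) ≤ c * (p : ℝ) ^ γ)
    (hblock : (p : ℝ) / (4 * m) ≤ B) (hR : R ≤ (p : ℝ) ^ κ')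
    (hE : 4 * c ^ 2 * (p : ℝ) ^ (-κ') ≤ E) : m * (R / B) ≤ E := by
  have hp0 : (0 : ℝ) < p := by exact_mod_cast hp
  have hm0 : (0 : ℝ) < m := by exact_mod_cast hm
  have hB0 : (0 : ℝ) < B := lt_of_lt_of_le (by positivity) hblock
  have h2 : (1 : ℝ) / B ≤ 4 * m / p := by
    rw [div_le_div_iff₀ hB0 hp0, one_mul]
    rw [div_le_iff₀ (by positivity)] at hblock
    linarith
  calc m * (R / B) ≤ m * ((p : ℝ) ^ κ' / B) := by gcongr
    _ = m * (p : ℝ) ^ κ' * (1 / B) := by ring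
    _ ≤ m * (p : ℝ) ^ κ' * (4 * m / p) := by gcongr
    _ = 4 * m ^ 2 * ((p : ℝ) ^ κ' / p) := by ring
    _ ≤ 4 * (c * (p : ℝ) ^ γ) ^ 2 * ((p : ℝ) ^ κ' / p) := by gcongr
    _ = 4 * c ^ 2 * ((p : ℝ) ^ γ * (p : ℝ) ^ γ * ((p : ℝ) ^ κ' / p)) := by ring
    _ = 4 * c ^ 2 * (p : ℝ) ^ (-κ') := by
        rw [← Real.rpow_add hp0, ← Real.rpow_sub_one hp0.ne', ← Real.rpow_add hp0]
        congr 2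
        rw [hκ']; ring
    _ ≤ _ := hE

set_option maxHeartbeats 800000 in
/-- The term `‖ξ‖ k log p / n` of the rate, for large `p`: only then are there enough coordinates
outside the support of the loading to hide the alternative among. -/
theorem highDim_rate {α M₁ M₂ c γ C cbar : ℝ} (hα : α < 1 / 2) (hM₁ : 1 < M₁) (hM₂ : 0 < M₂)
    (hc : 0 < c) (hγ : γ < 1 / 2) (hC : 0 < C) (hcbar : 1 ≤ cbar) :
    ∃ A : ℝ, 0 < A ∧ ∃ p₀ : ℕ, ∀ (n p k₁ k q : ℕ) (ξ : EuclideanSpace ℝ (Fin p)), p₀ ≤ p → 2 ≤ p →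
      1 ≤ n → 1 ≤ k → k₁ ≤ k → (1 ≤ k₁ ∨ 2 ≤ k) →
      (k : ℝ) ≤ c * (p : ℝ) ^ γ → k * (Real.log p / n) ≤ c →
      (q : ℝ) ≤ C * k → ξ ∈ Xi p q cbar →
      ∀ I ∈ confidenceIntervals n α (Theta M₁ M₂ p k) (fun β => inner ℝ ξ β),
        ENNReal.ofReal (A * (‖ξ‖ * (k * (Real.log p / n)))) ≤
          maxExpectedLength I (Theta M₁ M₂ p k₁) := by
  set ε := (1 - 2 * α) / 2 with hε
  have hε0 : 0 < ε := by rw [hε]; linarith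
  have hlog : 0 < Real.log (1 + ε ^ 2) := Real.log_pos (by nlinarith)
  set ω := √(min 1 (1 / (3 * C))) / cbar with hω
  have hω0 : 0 < ω := div_pos (Real.sqrt_pos.2 (lt_min one_pos (by positivity))) (by linarith)
  set G := 1 + M₂ ^ 2 with hG
  have hG0 : 0 < G := by positivity
  set η := min (1 / G) ((1 - 1 / M₁) / 3) with hη
  have hη0 : 0 < η := by
    refine lt_min (by positivity) ?_
    have : 1 / M₁ < 1 := by rw [div_lt_one (by linarith)]; exact hM₁
    linarith
  -- The exponent `κ'` solves `p ^ (2 γ) * p ^ κ' / p = p ^ (-κ')`.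
  set κ' := (1 - 2 * γ) / 2 with hκ'
  have hκ'0 : 0 < κ' := by rw [hκ']; linarith
  obtain ⟨κ, hκ0, hκ1, hκ2, hκ3⟩ := exists_correlation_strength hc hG0 hη0 hκ'0
  obtain ⟨p₀, hp₀⟩ := eventually_atTop.1 ((eventually_mul_rpow_le (by linarith : γ < 1)
    (2 * (C * c))).and ((eventually_mul_rpow_le (by linarith : γ < 1) (4 * c)).and
      (eventually_mul_rpow_neg_le hκ'0 (4 * c ^ 2) hlog)))
  refine ⟨ε * (κ * M₂ ^ 2 / 4 * ω), by positivity, p₀, ?_⟩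
  intro n p k₁ k q ξ hpp hp hn hk hk₁ hor hkp hkL hqk hξ I hI
  obtain ⟨e1, e2, e3⟩ := hp₀ p hpp
  have hq := one_le_of_mem_Xi hξ
  obtain ⟨v, hv, hv0, hvξ, hle⟩ := exists_direction hC hcbar hξ hk hq hqk
  have hp0 : (0 : ℝ) < p := by positivity
  have hn0 : (0 : ℝ) < n := by exact_mod_cast hn
  set L := Real.log p / n with hL
  have hL0 : 0 < L := div_pos (Real.log_pos (by exact_mod_cast hp)) hn0
  obtain ⟨m, hm1, hmk, hkm, hbm⟩ := exists_split hk hor hv0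
  have hm0 : (0 : ℝ) < m := by exact_mod_cast hm1
  have hmk' : (m : ℝ) ≤ k := by exact_mod_cast hmk
  have hkm' : (k : ℝ) ≤ 2 * m := by exact_mod_cast hkm
  have hmL : m * L ≤ c := le_trans (by gcongr) hkL
  have hmp : (m : ℝ) ≤ c * (p : ℝ) ^ γ := hmk'.trans hkp
  obtain ⟨g, hg⟩ := exists_blocks (m := m) hξ.1
  have hqp : 2 * q ≤ p := by
    have : 2 * (q : ℝ) ≤ p := by
      calc 2 * (q : ℝ) ≤ 2 * (C * (c * (p : ℝ) ^ γ)) := by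
            have : C * k ≤ C * (c * (p : ℝ) ^ γ) := by gcongr
            linarith
        _ = 2 * (C * c) * (p : ℝ) ^ γ := by ring
        _ ≤ p := e1
    exact_mod_cast this
  have hmp4 : 4 * m ≤ p := by
    have : 4 * (m : ℝ) ≤ p := by linarith
    exact_mod_cast this
  have hblock := div_four_le_block hm1 hqp hmp4
  set B := (p - q) / m
  have hB0 : (0 : ℝ) < B := lt_of_lt_of_le (by positivity) hblock
  have hB1 : 1 ≤ B := by exact_mod_cast hB0
  set a := √(κ * L) with ha
  have ha2 : a ^ 2 = κ * L := Real.sq_sqrt (by positivity)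
  have hmc : m * (κ * L) ≤ κ * c := by
    calc m * (κ * L) = κ * (m * L) := by ring
      _ ≤ _ := by gcongr
  have hm4 : m * (a ^ 2 * (1 + M₂ ^ 2)) ≤ 1 / 4 := by
    rw [ha2, ← hG, ← mul_assoc]
    exact (mul_le_mul_of_nonneg_right hmc hG0.le).trans hκ1
  have hsmall : 2 * (a * √m) + (1 + M₂ ^ 2) * (a * √m) ^ 2 ≤ 1 - 1 / M₁ := by
    have hx0 : 0 ≤ a * √m := by positivity
    have hx : a * √m ≤ η := by
      refine le_of_sq_le_sq ?_ hη0.le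
      rw [mul_pow, ha2, Real.sq_sqrt hm0.le, mul_comm]
      exact hmc.trans hκ2
    have hx1 : G * (a * √m) ≤ 1 := by
      calc G * (a * √m) ≤ G * (1 / G) := by gcongr; exact hx.trans (min_le_left _ _)
        _ = 1 := by field_simp
    have hx2 : a * √m ≤ (1 - 1 / M₁) / 3 := hx.trans (min_le_right _ _)
    rw [← hG]
    nlinarith
  have hchi : Real.exp (m * (Real.exp (n * (2 * (a ^ 2 * (1 + M₂ ^ 2)))) / B)) ≤ 1 + ε ^ 2 := by
    rw [← Real.le_log_iff_exp_le (by positivity)]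
    have hR : Real.exp (n * (2 * (a ^ 2 * (1 + M₂ ^ 2)))) ≤ (p : ℝ) ^ κ' := by
      rw [Real.rpow_def_of_pos hp0, ha2, ← hG]
      apply Real.exp_le_exp.2
      have : n * (2 * (κ * L * G)) = Real.log p * (2 * κ * G) := by rw [hL]; field_simp
      rw [this]
      have : 0 ≤ Real.log p := Real.log_natCast_nonneg p
      gcongr
    exact block_moment_le (by omega) hm1 hκ' hmp hblock hR e3
  set Y := m * a ^ 2 * M₂ ^ 2 with hY
  have hY0 : 0 ≤ Y := by positivity
  have hY1 : Y ≤ 1 := by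
    calc Y ≤ m * (a ^ 2 * (1 + M₂ ^ 2)) := by rw [hY, mul_assoc]; gcongr; linarith
      _ ≤ 1 := by linarith
  have hΔ : κ * M₂ ^ 2 / 4 * (k * L) ≤ Y / (1 + Y) := by
    calc κ * M₂ ^ 2 / 4 * (k * L) ≤ κ * M₂ ^ 2 / 4 * (2 * m * L) := by gcongr
      _ = Y / 2 := by rw [hY, ha2]; ring
      _ ≤ Y / (1 + Y) := by gcongr; linarith
  obtain ⟨b, hb1, hb2⟩ := hbm (Y / (1 + Y))
  have h := le_expectedLength_mixture (α := α) (b := b) hM₁ hM₂ le_rfl hε0 (Real.sqrt_nonneg _) hB1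
    hm4 hsmall hchi hv (fun x => hvξ _ (hg x)) hg (hb1.trans hk₁) hb2 hI
  refine (le_trans (ENNReal.ofReal_le_ofReal ?_) h).trans
    (expectedLength_le_maxExpectedLength (mem_Theta_one hM₁ hM₂ le_rfl hb1))
  have e4 : 1 - 2 * α - ε = ε := by rw [hε]; ring
  rw [e4, ← ha, ← hY]
  calc ε * (κ * M₂ ^ 2 / 4 * ω) * (‖ξ‖ * (k * L)) =
        ε * (κ * M₂ ^ 2 / 4 * (k * L) * (ω * ‖ξ‖)) := by ring
    _ ≤ _ := by gcongr

theorem benchmark_lower_bound {α M₁ M₂ c γ C cbar : ℝ} (hα : α < 1 / 2)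
    (hM₁ : 1 < M₁) (hM₂ : 0 < M₂) (hc : 0 < c) (hγ : γ < 1 / 2)
    (hC : 0 < C) (hcbar : 1 ≤ cbar) :
    ∃ c₁ : ℝ, 0 < c₁ ∧
      ∀ (n p k₁ k q : ℕ) (ξ : EuclideanSpace ℝ (Fin p)),
        1 ≤ n → 2 ≤ p → k₁ ≤ k → (1 ≤ k₁ ∨ 2 ≤ k) →
        (k : ℝ) ≤ c * min ((p : ℝ) ^ γ) (n / Real.log p) →
        (q : ℝ) ≤ C * k → ξ ∈ Xi p q cbar →
        ENNReal.ofReal (c₁ * rate n k ξ) ≤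
          benchmark n α (Theta M₁ M₂ p k₁) (Theta M₁ M₂ p k) (fun β => inner ℝ ξ β) := by
  obtain ⟨A, hA, hpar⟩ := parametric_rate hα hM₁ hM₂ hC hcbar
  obtain ⟨A', hA', p₀, hhigh⟩ := highDim_rate (γ := γ) hα hM₁ hM₂ hc hγ hC hcbar
  -- For `p < p₀`, the term `k log p / n` is at most `K / √n`.
  set K := c * p₀ * p₀ with hK
  have hK0 : 0 ≤ K := by positivity
  refine ⟨min A A' / 2 / (1 + K), by positivity, ?_⟩
  intro n p k₁ k q ξ hn hp hk₁ hor hkc hqk hξ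
  refine le_iInf₂ fun I hI => ?_
  have hk : 1 ≤ k := by omega
  have hn0 : (0 : ℝ) < n := by exact_mod_cast hn
  have hn1 : (1 : ℝ) ≤ n := by exact_mod_cast hn
  have hp1 : (1 : ℝ) ≤ p := by exact_mod_cast (by omega : 1 ≤ p)
  have hlogp : 0 < Real.log p := Real.log_pos (by exact_mod_cast hp)
  have hkp : (k : ℝ) ≤ c * (p : ℝ) ^ γ := hkc.trans (by gcongr; exact min_le_left _ _)
  have hkL : k * (Real.log p / n) ≤ c := by
    have : (k : ℝ) ≤ c * (n / Real.log p) := hkc.trans (by gcongr; exact min_le_right _ _)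
    calc k * (Real.log p / n) ≤ c * (n / Real.log p) * (Real.log p / n) := by gcongr
      _ = c := by field_simp
  have h1 := hpar n p k₁ k q ξ hn hk hqk hξ I hI
  set x := ‖ξ‖ * (1 / √n) with hx
  set y := ‖ξ‖ * (k * (Real.log p / n)) with hy
  have hx0 : 0 ≤ x := by positivity
  have hy0 : 0 ≤ y := by positivity
  have hrate : rate n k ξ = x + y := by rw [rate, mul_add]
  rw [hrate]
  have hmin0 : 0 < min A A' := lt_min hA hA'
  rcases Nat.lt_or_ge p p₀ with hpp | hpp
  · refine (ENNReal.ofReal_le_ofReal ?_).trans h1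
    have hyx : y ≤ K * x := by
      have hpp' : (p : ℝ) ≤ p₀ := by exact_mod_cast hpp.le
      have hkp₀ : (k : ℝ) ≤ c * p₀ := by
        refine hkp.trans ?_
        gcongr
        calc (p : ℝ) ^ γ ≤ (p : ℝ) ^ (1 : ℝ) :=
              Real.rpow_le_rpow_of_exponent_le hp1 (by linarith)
          _ ≤ p₀ := by rwa [Real.rpow_one]
      have hl : Real.log p ≤ p₀ := (Real.log_le_self (by positivity)).trans hpp'
      have hnn : (1 : ℝ) / n ≤ 1 / √n := by
        have hs : √(n : ℝ) ≤ n := Real.sqrt_le_iff.2 ⟨hn0.le, by nlinarith⟩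
        exact one_div_le_one_div_of_le (Real.sqrt_pos.2 hn0) hs
      calc y = ‖ξ‖ * (k * Real.log p * (1 / n)) := by rw [hy]; ring
        _ ≤ ‖ξ‖ * (c * p₀ * p₀ * (1 / √n)) := by gcongr
        _ = K * x := by rw [hK, hx]; ring
    calc min A A' / 2 / (1 + K) * (x + y) ≤ min A A' / 2 / (1 + K) * ((1 + K) * x) := by
          gcongr; linarith
      _ = min A A' / 2 * x := by field_simp
      _ ≤ A * x := by gcongr; linarith [min_le_left A A']
  · have h2 := hhigh n p k₁ k q ξ hpp hp hn hk hk₁ hor hkp hkL hqk hξ I hI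
    refine le_trans (ENNReal.ofReal_le_ofReal ?_) ((ENNReal.ofReal_max _ _).trans_le (max_le h1 h2))
    calc min A A' / 2 / (1 + K) * (x + y) ≤ min A A' / 2 * (x + y) := by
          exact mul_le_mul_of_nonneg_right (div_le_self (half_pos hmin0).le (by linarith))
            (add_nonneg hx0 hy0)
      _ = (min A A' * x + min A A' * y) / 2 := by ring
      _ ≤ (A * x + A' * y) / 2 := by
          have := mul_le_mul_of_nonneg_right (min_le_left A A') hx0
          have := mul_le_mul_of_nonneg_right (min_le_right A A') hy0
          linarith
      _ ≤ max (A * x) (A' * y) := by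
          have := le_max_left (A * x) (A' * y)
          have := le_max_right (A * x) (A' * y)
          linarith

end Regime

/-! ### Divergence of the ratio to the rate of the smaller class -/

theorem theorem2 (α M₁ M₂ c γ C cbar : ℝ) (hα0 : 0 < α) (hα : α < 1 / 2)
    (hM₁ : 1 < M₁) (hM₂ : 0 < M₂) (hc : 0 < c) (hγ0 : 0 ≤ γ) (hγ : γ < 1 / 2)
    (hC : 0 < C) (hcbar : 1 ≤ cbar) :
    (∃ c₁ : ℝ, 0 < c₁ ∧
      ∀ (n p k₁ k q : ℕ) (ξ : EuclideanSpace ℝ (Fin p)),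
        1 ≤ n → 2 ≤ p → k₁ ≤ k → (1 ≤ k₁ ∨ 2 ≤ k) →
        (k : ℝ) ≤ c * min ((p : ℝ) ^ γ) (n / Real.log p) →
        (q : ℝ) ≤ C * k → ξ ∈ Xi p q cbar →
        ENNReal.ofReal (c₁ * rate n k ξ) ≤
          benchmark n α (Theta M₁ M₂ p k₁) (Theta M₁ M₂ p k) (fun β => inner ℝ ξ β)) ∧
    (∀ (n p k₁ k q : ℕ → ℕ) (ξ : ∀ m, EuclideanSpace ℝ (Fin (p m))),
        (∀ m, 1 ≤ n m ∧ 2 ≤ p m ∧ k₁ m ≤ k m ∧ (1 ≤ k₁ m ∨ 2 ≤ k m) ∧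
          (k m : ℝ) ≤ c * min ((p m : ℝ) ^ γ) (n m / Real.log (p m)) ∧
          (q m : ℝ) ≤ C * k m ∧ ξ m ∈ Xi (p m) (q m) cbar) →
        Tendsto (fun m => (k₁ m : ℝ) / k m) atTop (𝓝 0) →
        Tendsto (fun m => (√(n m : ℝ) / Real.log (p m)) / k m) atTop (𝓝 0) →
        Tendsto (fun m =>
            benchmark (n m) α (Theta M₁ M₂ (p m) (k₁ m)) (Theta M₁ M₂ (p m) (k m))
                (fun β => inner ℝ (ξ m) β) /
              ENNReal.ofReal (rate (n m) (k₁ m) (ξ m)))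
          atTop (𝓝 ⊤)) := by
  have hmain := benchmark_lower_bound (γ := γ) hα hM₁ hM₂ hc hγ hC hcbar
  refine ⟨hmain, ?_⟩
  obtain ⟨c₁, hc₁, hlow⟩ := hmain
  intro n p k₁ k q ξ hyp hk₁k hnk
  set r : ℕ → ℝ := fun m => (√(n m : ℝ) / Real.log (p m)) / k m + (k₁ m : ℝ) / k m with hr
  have hr0 : ∀ m, 0 < r m := by
    intro m
    obtain ⟨hn, hp, hk, hor, -⟩ := hyp m
    have h1 : (0 : ℝ) < n m := by exact_mod_cast hn
    have h2 : (0 : ℝ) < k m := by exact_mod_cast (by omega : 0 < k m)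
    have h3 : 0 < Real.log (p m) := Real.log_pos (by exact_mod_cast hp)
    positivity
  have hrlim : Tendsto r atTop (𝓝[>] 0) := by
    refine tendsto_nhdsWithin_iff.2 ⟨?_, Eventually.of_forall hr0⟩
    simpa using hnk.add hk₁k
  have hlim : Tendsto (fun m => ENNReal.ofReal (c₁ * (r m)⁻¹)) atTop (𝓝 ⊤) :=
    ENNReal.tendsto_ofReal_nhds_top.2 (hrlim.inv_tendsto_nhdsGT_zero.const_mul_atTop hc₁)
  refine tendsto_nhds_top_mono hlim (Eventually.of_forall fun m => ?_)
  obtain ⟨hn, hp, hk, hor, hkc, hqk, hξ⟩ := hyp m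
  have h1 : (0 : ℝ) < n m := by exact_mod_cast hn
  have h2 : (0 : ℝ) < k m := by exact_mod_cast (by omega : 0 < k m)
  have h3 : 0 < Real.log (p m) := Real.log_pos (by exact_mod_cast hp)
  have h4 : 0 < ‖ξ m‖ := norm_pos_iff.2 hξ.2.1
  have hrate : rate (n m) (k₁ m) (ξ m) =
      ‖ξ m‖ * (k m * (Real.log (p m) / n m)) * r m := by
    have hsq : √(n m : ℝ) ^ 2 = n m := Real.sq_sqrt h1.le
    have hs : 0 < √(n m : ℝ) := Real.sqrt_pos.2 h1
    rw [rate, hr]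
    have : (1 : ℝ) / √(n m : ℝ) = √(n m : ℝ) / n m := by
      rw [div_eq_div_iff hs.ne' h1.ne']; linarith
    rw [this]
    field_simp
  have hpos : 0 < rate (n m) (k₁ m) (ξ m) := by
    have := hr0 m
    rw [hrate]; positivity
  have hle := hlow (n m) (p m) (k₁ m) (k m) (q m) (ξ m) hn hp hk hor hkc hqk hξ
  dsimp only
  rw [ENNReal.le_div_iff_mul_le (Or.inl (by simpa using hpos)) (Or.inl ENNReal.ofReal_ne_top),
    ← ENNReal.ofReal_mul (by have := hr0 m; positivity)]
  refine le_trans (ENNReal.ofReal_le_ofReal ?_) hle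
  have hrne := (hr0 m).ne'
  calc c₁ * (r m)⁻¹ * rate (n m) (k₁ m) (ξ m) = c₁ * (‖ξ m‖ * (k m * (Real.log (p m) / n m))) := by
        rw [hrate]; field_simp
    _ ≤ c₁ * rate (n m) (k m) (ξ m) := by
        rw [rate]
        gcongr
        have : 0 ≤ 1 / √(n m : ℝ) := by positivity
        linarith
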